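/- **Conventions.** Let $\mathcal D$ be the grid of half-open dyadic squares $Q=[a2^{-k},(a+1)2^{-k})\times[b2^{-k},(b+1)2^{-k})$, $k,a,b\in\mathbb Z$, of $\mathbb R^2$, with side length $\ell(Q)=2^{-k}$; let $3Q$ be the union of $Q$ and its eight neighbours of the same side length. For a Radon measure $\mu$ on $\mathbb R^2$ and a square $S$ with $\mu(S)>0$ put $$\beta_{2,\mu}(S)=\inf_L\left[\frac1{\mu(S)}\int_S\left(\frac{d(y,L)}{\operatorname{diam}(S)}\right)^2d\mu(y)\right]^{1/2},$$ the infimum being over all affine lines $L\subset\mathbb R^2$. For $x\in\operatorname{spt}\mu$ put $$J_1(x)=\sum_{Q\in\mathcal D,\ \ell(Q)\le 1}\beta_{2,\mu}^2(3Q)\,\frac{\ell(Q)}{\mu(Q)}\,1_Q(x)\in[0,\infty],$$ where $\ell(Q)/\mu(Q)=\infty$ if $\mu(Q)=0$, and $0\cdot\infty=0$. Further put $$\Theta^1_*(\mu,x)=\liminf_{r\to0+}\frac{\mu(B(x,r))}{2r},$$ where $B(x,r)$ is the open ball. The measure $\mu$ is *$1$-rectifiable* if there are Lipschitz maps $f_i\colon\mathbb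 R\to\mathbb R^2$, $i\in\mathbb N$, with $\mu(\mathbb R^2\setminus\bigcup_i f_i(\mathbb R))=0$, and *purely $1$-unrectifiable* if $\mu(f(\mathbb R))=0$ for every Lipschitz map $f\colon\mathbb R\to\mathbb R^2$. **Theorem 1.1.** For every $\varepsilon>0$ there exists a Radon probability measure $\mu$ on $\mathbb R^2$ with $\operatorname{spt}\mu\subset[0,1]^2$ such that 1. $J_1(x)\le\varepsilon$ for every $x\in\operatorname{spt}\mu$; 2. $\Theta^1_*(\mu,x)=0$ for $\mu$-a.e. $x$. In particular, $\mu$ is purely $1$-unrectifiable, and hence not $1$-rectifiable (so boundedness of $J_1$ on $\operatorname{spt}\mu$ does not imply $1$-rectifiability, which answers a question of Badger and Schul in the negative). -/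

import Mathlib

open MeasureTheory Filter Topology
open scoped ENNReal

/-- The Euclidean plane. -/
abbrev Plane : Type := EuclideanSpace ℝ (Fin 2)

/-- The closed unit square `[0,1]²`. -/
def unitSquare : Set Plane := {x | ∀ i, x i ∈ Set.Icc (0 : ℝ) 1}

/-- A square of the standard dyadic grid, recorded by its generation `k` (side length `2⁻ᵏ`) and
the integer position of its lower left corner `2⁻ᵏ • corner`. -/
structure DyadicSquare where
  k : ℤ
  corner : Fin 2 → ℤ

namespace DyadicSquare

/-- The side length `ℓ(Q)`. -/
noncomputable def side (Q : DyadicSquare) : ℝ := (2 : ℝ) ^ (-Q.k)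

/-- The (half-open) square itself. -/
def toSet (Q : DyadicSquare) : Set Plane :=
  {x | ∀ i, x i ∈ Set.Ico ((Q.corner i : ℝ) * Q.side) (((Q.corner i : ℝ) + 1) * Q.side)}

/-- `3Q`: the union of `Q` and its eight dyadic neighbours. -/
def triple (Q : DyadicSquare) : Set Plane :=
  {x | ∀ i, x i ∈ Set.Ico (((Q.corner i : ℝ) - 1) * Q.side) (((Q.corner i : ℝ) + 2) * Q.side)}

end DyadicSquare

/-- The number `β_{2,μ}(S)`, for `S` a square with `μ S > 0`; the infimum is over all affine
lines of the plane. -/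
noncomputable def beta2 (μ : Measure Plane) (S : Set Plane) : ℝ≥0∞ :=
  ⨅ (L : AffineSubspace ℝ Plane) (_ : Module.finrank ℝ L.direction = 1),
    ((μ S)⁻¹ * ∫⁻ y in S, (Metric.infEDist y (L : Set Plane) / Metric.ediam S) ^ 2 ∂μ)
      ^ (1 / 2 : ℝ)

/-- The density normalised Jones square function `J₁`, with values in `[0,∞]`. For `x` in the
support of `μ` each `3Q` with `x ∈ Q` has positive measure; a square `Q ∋ x` with `μ Q = 0`
contributes `∞` unless `β_{2,μ}(3Q) = 0`. -/
noncomputable def jonesSquare (μ : Measure Plane) (x : Plane) : ℝ≥0∞ :=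
  ∑' Q : {Q : DyadicSquare // Q.side ≤ 1},
    Q.1.toSet.indicator
      (fun _ => beta2 μ Q.1.triple ^ 2 * (ENNReal.ofReal Q.1.side / μ Q.1.toSet)) x

/-- The lower `1`-density `liminf_{r → 0} μ(B(x,r)) / (2r)`. -/
noncomputable def lowerDensityOne (μ : Measure Plane) (x : Plane) : ℝ≥0∞ :=
  liminf (fun r : ℝ => μ (Metric.ball x r) / ENNReal.ofReal (2 * r)) (𝓝[>] (0 : ℝ))

/-- `μ` is `1`-rectifiable: countably many Lipschitz images of `ℝ` cover `μ`-almost everything. -/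
def IsOneRectifiable (μ : Measure Plane) : Prop :=
  ∃ f : ℕ → ℝ → Plane, (∀ i, ∃ K, LipschitzWith K (f i)) ∧ μ (⋃ i, Set.range (f i))ᶜ = 0

/-- `μ` is purely `1`-unrectifiable: every Lipschitz image of `ℝ` is `μ`-null. -/
def IsPurelyOneUnrectifiable (μ : Measure Plane) : Prop :=
  ∀ (f : ℝ → Plane) (K : NNReal), LipschitzWith K f → μ (Set.range f) = 0

/-! The measure is the law of a random point of a Cantor set of nested dyadic squares. Inside a
stage `n` square the children form one main row near the bottom, of relative mass `1 / (n + 2)`, and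
`M n` rows at relative heights `4 ^ (-j)`, `1 ≤ j ≤ M n`, sharing the remaining mass equally; these
are low in density, not in height. Positions within a row are uniform and all stages are
independent.

Density: at relative generation `2 * j + 1` a tripled square around a point of row `j ≠ 0` meets no
other row, so the density there is at most about `2 ^ K n / M n`, which the choice of `M n` makes
small. The main row has probability `1 / (n + 2) → 0`, so almost every point lies in low rows
infinitely often and has lower density zero. A Vitali covering of the parameter line then shows that
Lipschitz curves are null.

Square function: between two stages a tripled square is of one of two kinds. If it meets a single
row, its `β` is at most the ratio of a child's side to its own, and the scales sum geometrically.
Otherwise it contains a piece of the main row, against which every low row has relative mass `(n +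
1) / M n`; the heights decay geometrically, so `β ^ 2` is of order `(n + 1) / M n`. Multiplied by `ℓ
/ μ`, this is affordable on the `2 * M n + 1` scales where the square itself contains main row mass.
For a point of row `j`, the single scale `t = 2 * j` has its triple reaching the main row while the
square does not; there `ℓ / μ` gains a factor of order `M n`, but only once. What remains is a
factor polynomial in `n` times the inverse density `W n / 2 ^ K n` of the stage, which is made
summable by taking `L n` large after `M n`. -/

/-! ### Vanishing lower density implies pure unrectifiability -/

/-- Along arbitrarily small radii a point of lower density zero has small balls of small mass. -/
lemma exists_small_ball_of_lowerDensityOne_eq_zero {μ : Measure Plane} {x : Plane}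
    (h : lowerDensityOne μ x = 0) {c : ℝ} (hc : 0 < c) :
    ∃ r : ℝ, 0 < r ∧ r < 1 ∧ μ (Metric.ball x r) ≤ ENNReal.ofReal (c * (2 * r)) := by
  have hlt : liminf (fun r : ℝ => μ (Metric.ball x r) / ENNReal.ofReal (2 * r)) (𝓝[>] (0 : ℝ))
      < ENNReal.ofReal c := by
    rw [lowerDensityOne] at h
    rw [h]
    simpa using hc
  have hev : ∀ᶠ r in 𝓝[>] (0 : ℝ), r ∈ Set.Ioo (0 : ℝ) 1 := Ioo_mem_nhdsGT one_pos
  obtain ⟨r, hr, hr0, hr1⟩ := ((frequently_lt_of_liminf_lt (by isBoundedDefault) hlt).and_eventually hev).exists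
  refine ⟨r, hr0, hr1, ?_⟩
  have h2 : ENNReal.ofReal (2 * r) ≠ 0 := by
    simp [hr0]
  rw [ENNReal.ofReal_mul hc.le]
  exact ((ENNReal.div_lt_iff (Or.inl h2) (Or.inl ENNReal.ofReal_ne_top)).1 hr).le

/-- A bounded piece of a Lipschitz curve consisting of points of lower density zero is null. -/
lemma measure_image_eq_zero_of_lowerDensityOne_eq_zero {μ : Measure Plane} {f : ℝ → Plane}
    {K : NNReal} (hf : LipschitzWith K f) {N : ℝ} (hN : 0 < N) {A : Set ℝ}
    (hA : A ⊆ Set.Icc (-N) N) (h : ∀ s ∈ A, lowerDensityOne μ (f s) = 0) :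
    μ (f '' A) = 0 := by
  set κ : ℝ := K + 1 with hκ
  have hκ1 : 1 ≤ κ := by simp [hκ]
  have hκ0 : 0 < κ := by linarith
  have hdist : ∀ s t, dist (f s) (f t) ≤ κ * dist s t := fun s t =>
    (hf.dist_le_mul s t).trans (by gcongr; simp [hκ])
  have key : ∀ c : ℝ, 0 < c → μ (f '' A) ≤ ENNReal.ofReal (6 * κ * c * (2 * N + 2)) := by
    intro c hc
    have hex : ∀ s, ∃ r : ℝ, s ∈ A →
        0 < r ∧ r < 1 ∧ μ (Metric.ball (f s) r) ≤ ENNReal.ofReal (c * (2 * r)) := by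
      intro s
      by_cases hs : s ∈ A
      · obtain ⟨r, hr⟩ := exists_small_ball_of_lowerDensityOne_eq_zero (h s hs) hc
        exact ⟨r, fun _ => hr⟩
      · exact ⟨0, fun h => absurd h hs⟩
    choose r hr using hex
    obtain ⟨u, huA, hdisj, hcov⟩ :=
      Vitali.exists_disjoint_subfamily_covering_enlargement_closedBall A id
        -- The intervals live on the parameter line. After the fivefold Vitali enlargement, `f`
        -- stretches lengths by at most `κ`, and `5 / 6 < 1` keeps the images inside the balls of
        -- radius `r s`. No measurability of `A` is needed.
        (fun s => r s / (6 * κ)) 1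
        (fun s hs => by
          rw [div_le_one (by positivity)]
          nlinarith [(hr s hs).2.1]) 5 (by norm_num)
    have hpos : ∀ s ∈ u, 0 < r s / (6 * κ) := fun s hs => div_pos (hr s (huA hs)).1 (by positivity)
    have hcount : u.Countable := by
      refine hdisj.countable_of_nonempty_interior fun s hs => ?_
      exact ⟨s, Metric.ball_subset_interior_closedBall (Metric.mem_ball_self (hpos s hs))⟩
    have hsub : f '' A ⊆ ⋃ s ∈ u, Metric.ball (f s) (r s) := by
      rintro _ ⟨s, hs, rfl⟩
      obtain ⟨b, hb, hsb⟩ := hcov s hs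
      have hmem := hsb (Metric.mem_closedBall_self (div_pos (hr s hs).1 (by positivity)).le)
      simp only [id, Metric.mem_closedBall] at hmem
      simp only [Set.mem_iUnion]
      refine ⟨b, hb, ?_⟩
      rw [Metric.mem_ball]
      have hb0 := (hr b (huA hb)).1
      calc dist (f s) (f b) ≤ κ * dist s b := hdist _ _
        _ ≤ κ * (5 * (r b / (6 * κ))) := by gcongr
        _ = 5 / 6 * r b := by field_simp
        _ < r b := by linarith
    calc μ (f '' A) ≤ μ (⋃ s ∈ u, Metric.ball (f s) (r s)) := measure_mono hsub
      _ ≤ ∑' s : u, μ (Metric.ball (f s) (r s)) := measure_biUnion_le μ hcount _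
      _ ≤ ∑' s : u, ENNReal.ofReal (6 * κ * c) *
            volume (Metric.closedBall (s : ℝ) (r s / (6 * κ))) := by
          refine ENNReal.tsum_le_tsum fun s => (hr s (huA s.2)).2.2.trans (le_of_eq ?_)
          rw [Real.volume_closedBall, ← ENNReal.ofReal_mul (by positivity)]
          congr 1
          field_simp
      _ = ENNReal.ofReal (6 * κ * c) *
            volume (⋃ s ∈ u, Metric.closedBall (s : ℝ) (r s / (6 * κ))) := by
          have hU := measure_biUnion (μ := volume) hcount hdisj
            fun s _ => Metric.isClosed_closedBall.measurableSet
          simp only [id] at hU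
          rw [ENNReal.tsum_mul_left, hU]
      _ ≤ ENNReal.ofReal (6 * κ * c) * volume (Set.Icc (-N - 1) (N + 1)) := by
          gcongr
          refine Set.iUnion₂_subset fun s hs => ?_
          have h1 := hA (huA hs)
          have h2 : r s / (6 * κ) ≤ 1 := by
            rw [div_le_one (by positivity)]
            nlinarith [(hr s (huA hs)).2.1]
          rw [Real.closedBall_eq_Icc]
          exact Set.Icc_subset_Icc (by linarith [h1.1]) (by linarith [h1.2])
      _ = ENNReal.ofReal (6 * κ * c * (2 * N + 2)) := by
          rw [Real.volume_Icc, ← ENNReal.ofReal_mul (by positivity)]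
          congr 2
          ring
  refine le_antisymm (ENNReal.le_of_forall_pos_le_add fun e he _ => ?_) zero_le
  have he' : (0 : ℝ) < e := he
  have := key (e / (6 * κ * (2 * N + 2))) (by positivity)
  rw [zero_add]
  refine this.trans (le_of_eq ?_)
  rw [show 6 * κ * ((e : ℝ) / (6 * κ * (2 * N + 2))) * (2 * N + 2) = e by field_simp]
  exact ENNReal.ofReal_coe_nnreal

/-- A measure of vanishing lower density does not charge Lipschitz curves. -/
theorem isPurelyOneUnrectifiable_of_lowerDensityOne {μ : Measure Plane}
    (h : ∀ᵐ x ∂μ, lowerDensityOne μ x = 0) : IsPurelyOneUnrectifiable μ := by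
  intro f K hf
  set A : ℕ → Set ℝ := fun n => {s | s ∈ Set.Icc (-((n : ℝ) + 1)) (n + 1) ∧
    lowerDensityOne μ (f s) = 0}
  have hsub : Set.range f ⊆ (⋃ n, f '' A n) ∪ {x | ¬ lowerDensityOne μ x = 0} := by
    rintro _ ⟨s, rfl⟩
    by_cases hs : lowerDensityOne μ (f s) = 0
    · left
      obtain ⟨n, hn⟩ := exists_nat_ge |s|
      refine Set.mem_iUnion.2 ⟨n, s, ⟨?_, hs⟩, rfl⟩
      rw [abs_le] at hn
      constructor <;> linarith
    · exact Or.inr hs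
  refine measure_mono_null hsub (measure_union_null (measure_iUnion_null fun n => ?_) (ae_iff.1 h))
  exact measure_image_eq_zero_of_lowerDensityOne_eq_zero hf (by positivity)
    (fun s hs => hs.1) fun s hs => hs.2

theorem not_isOneRectifiable_of_isPurelyOneUnrectifiable {μ : Measure Plane}
    [IsProbabilityMeasure μ] (h : IsPurelyOneUnrectifiable μ) : ¬ IsOneRectifiable μ := by
  rintro ⟨f, hf, hnull⟩
  have h1 : μ (⋃ i, Set.range (f i)) = 0 :=
    measure_iUnion_null fun i => (hf i).elim fun K hK => h (f i) K hK
  have h2 : μ Set.univ = 0 := by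
    rw [← Set.union_compl_self (⋃ i, Set.range (f i))]
    exact measure_union_null h1 hnull
  simp at h2

/-! ### Parameters and integer corners of the nested squares -/

/-- The parameters of the construction. Squares of stage `n` have generation `K n`; a square of
stage `n` is subdivided `L n` times, its children form `M n` low rows and one main row of
`2 ^ (2 * M n + 2)` squares each, and every cylinder of length `n` has mass at least `1 / W n`. -/
structure Scheme where
  N : ℕ
  K : ℕ → ℕ
  L : ℕ → ℕ
  M : ℕ → ℕ
  W : ℕ → ℕ
  K_succ : ∀ n, K (n + 1) = K n + L n
  two_mul_add_four_le : ∀ n, 2 * M n + 4 ≤ L n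
  le_M : ∀ n, (n + 1) * 2 ^ K n ≤ M n
  W_zero : W 0 = 1
  W_succ : ∀ n, W (n + 1) = W n * (2 ^ (2 * M n + 2) * ((n + 2) * M n))
  density : ∀ n, N * ((n + 2) ^ 2 * 2 ^ n) * W n ≤ 2 ^ K n

namespace Scheme

theorem exists_scheme (N : ℕ) : ∃ S : Scheme, S.N = N := by
  let g : ℕ → ℕ := fun n => N * ((n + 2) ^ 2 * 2 ^ n)
  let M : ℕ → ℕ × ℕ → ℕ := fun n s => (n + 1) * 2 ^ s.1
  let W' : ℕ → ℕ × ℕ → ℕ := fun n s =>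
    s.2 * (2 ^ (2 * M n s + 2) * ((n + 2) * M n s))
  -- The recursion carries the pair `(K n, W n)`. `M` depends on `K n` only and determines the next
  -- `W`, so `L` can be chosen last, large enough for the next density condition through `x < 2 ^
  -- x`.
  let L : ℕ → ℕ × ℕ → ℕ := fun n s => 2 * M n s + 4 + g (n + 1) * W' n s
  let st : ℕ → ℕ × ℕ := fun n => Nat.rec (g 0, 1) (fun n s => (s.1 + L n s, W' n s)) n
  refine ⟨⟨N, fun n => (st n).1, fun n => L n (st n), fun n => M n (st n), fun n => (st n).2,
    fun n => rfl, fun n => Nat.le_add_right _ _, fun n => le_rfl, rfl, fun n => rfl, ?_⟩, rfl⟩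
  intro n
  cases n with
  | zero => simpa [st, g] using (Nat.lt_two_pow_self (n := g 0)).le
  | succ n =>
    calc g (n + 1) * W' n (st n) ≤ (st n).1 + L n (st n) := by
          simp only [L]
          omega
      _ ≤ 2 ^ ((st n).1 + L n (st n)) := (Nat.lt_two_pow_self).le

variable (S : Scheme)

lemma M_pos (n : ℕ) : 0 < S.M n := lt_of_lt_of_le (by positivity) (S.le_M n)

lemma W_pos (n : ℕ) : 0 < S.W n := by
  induction n with
  | zero => rw [S.W_zero]; exact one_pos
  | succ n ih =>
    have := S.M_pos n
    rw [S.W_succ]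
    positivity

lemma le_K (n : ℕ) : n ≤ S.K n := by
  induction n with
  | zero => omega
  | succ n ih =>
    have := S.two_mul_add_four_le n
    rw [S.K_succ]
    omega

/-- The labels of the children of a stage `n` square: position in the row and row. -/
abbrev Label (n : ℕ) : Type := Fin (2 ^ (2 * S.M n + 2)) × Fin (S.M n + 1)

abbrev Code : Type := ∀ n, S.Label n

/-- The position of a child in the grid of mesh `2⁻ᴸ` of its parent. -/
def digit (e : Fin 2) (n : ℕ) (p : S.Label n) : ℕ :=
  if e = 0 then p.1 * 2 ^ (S.L n - (2 * S.M n + 2)) + 1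
  else if (p.2 : ℕ) = 0 then 1 else 2 ^ (S.L n - 2 * p.2)

lemma digit_zero (n : ℕ) (p : S.Label n) :
    S.digit 0 n p = p.1 * 2 ^ (S.L n - (2 * S.M n + 2)) + 1 := rfl

lemma digit_one (n : ℕ) (p : S.Label n) :
    S.digit 1 n p = if (p.2 : ℕ) = 0 then 1 else 2 ^ (S.L n - 2 * p.2) := rfl

lemma four_le_two_pow {n : ℕ} (h : 2 ≤ n) : 4 ≤ 2 ^ n := by
  calc 4 = 2 ^ 2 := rfl
    _ ≤ 2 ^ n := Nat.pow_le_pow_right two_pos h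

lemma one_le_digit (e : Fin 2) (n : ℕ) (p : S.Label n) : 1 ≤ S.digit e n p := by
  unfold digit
  split_ifs
  · omega
  · exact le_rfl
  · exact Nat.one_le_two_pow

/-- With `one_le_digit` this leaves an empty cell along each side of the parent. Hence children of
different parents are never adjacent, and a child ends strictly before its parent does. -/
lemma digit_add_two_le (e : Fin 2) (n : ℕ) (p : S.Label n) : S.digit e n p + 2 ≤ 2 ^ S.L n := by
  have hL := S.two_mul_add_four_le n
  have h16 : 4 ≤ 2 ^ S.L n := four_le_two_pow (by omega)
  unfold digit
  split_ifs with h0 h1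
  · have h4 : 4 ≤ 2 ^ (S.L n - (2 * S.M n + 2)) := by
      calc 4 = 2 ^ 2 := rfl
        _ ≤ _ := Nat.pow_le_pow_right two_pos (by omega)
    have hp : (p.1 : ℕ) + 1 ≤ 2 ^ (2 * S.M n + 2) := p.1.2
    have he : 2 ^ (2 * S.M n + 2) * 2 ^ (S.L n - (2 * S.M n + 2)) = 2 ^ S.L n := by
      rw [← pow_add]; congr 1; omega
    nlinarith
  · omega
  · have : 2 ^ (S.L n - 2 * (p.2 : ℕ)) * 2 ≤ 2 ^ S.L n := by
      rw [← pow_succ]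
      exact Nat.pow_le_pow_right two_pos (by omega)
    omega

/-- Distinct children of a square are not adjacent. -/
lemma label_eq_of_digit_close {n : ℕ} {p p' : S.Label n}
    (h : ∀ e, S.digit e n p ≤ S.digit e n p' + 1 ∧ S.digit e n p' ≤ S.digit e n p + 1) :
    p = p' := by
  have hL := S.two_mul_add_four_le n
  have h0 := h 0
  have h1 := h 1
  rw [digit_zero, digit_zero] at h0
  rw [digit_one, digit_one] at h1
  have h4 : 4 ≤ 2 ^ (S.L n - (2 * S.M n + 2)) := four_le_two_pow (by omega)
  refine Prod.ext (Fin.ext ?_) (Fin.ext ?_)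
  · rcases lt_trichotomy (p.1 : ℕ) p'.1 with hlt | heq | hlt
    · nlinarith [h0.2]
    · exact heq
    · nlinarith [h0.1]
  · have hp := p.2.2
    have hp' := p'.2.2
    by_contra hne
    have aux : ∀ a b : ℕ, a ≤ S.M n → b ≤ S.M n → a < b →
        2 ^ (S.L n - 2 * b) + 4 ≤ 2 ^ (S.L n - 2 * a) := by
      intro a b ha hb hab
      have h1 : 4 ≤ 2 ^ (S.L n - 2 * b) := four_le_two_pow (by omega)
      have h2 : 2 ^ (S.L n - 2 * b) * 2 ≤ 2 ^ (S.L n - 2 * a) := by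
        rw [← pow_succ]
        exact Nat.pow_le_pow_right two_pos (by omega)
      omega
    have hbig : ∀ a : ℕ, a ≤ S.M n → 4 ≤ 2 ^ (S.L n - 2 * a) := fun a ha =>
      four_le_two_pow (by omega)
    split_ifs at h1 with ha hb hb
    · omega
    · have := hbig p'.2 (by omega); omega
    · have := hbig p.2 (by omega); omega
    · rcases Nat.lt_or_gt_of_ne hne with hlt | hlt
      · have := aux p.2 p'.2 (by omega) (by omega) hlt; omega
      · have := aux p'.2 p.2 (by omega) (by omega) hlt; omega

/-- The corner of the stage `n` square with code `ω`, in units of `2 ^ (- K n)`. -/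
def corner (e : Fin 2) (ω : S.Code) : ℕ → ℕ
  | 0 => 0
  | n + 1 => corner e ω n * 2 ^ S.L n + S.digit e n (ω n)

lemma corner_congr {e : Fin 2} {ω ω' : S.Code} {n : ℕ} (h : ∀ i < n, ω i = ω' i) :
    S.corner e ω n = S.corner e ω' n := by
  induction n with
  | zero => rfl
  | succ n ih =>
    rw [corner, corner, ih fun i hi => h i (hi.trans n.lt_succ_self), h n n.lt_succ_self]

/-- Distinct squares of the same stage are not adjacent. -/
lemma eq_of_corner_close {ω ω' : S.Code} {n : ℕ}
    (h : ∀ e, S.corner e ω n ≤ S.corner e ω' n + 1 ∧ S.corner e ω' n ≤ S.corner e ω n + 1) :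
    ∀ i < n, ω i = ω' i := by
  induction n with
  | zero => intro i hi; omega
  | succ n ih =>
    -- If the parents' corners differ in a coordinate, the empty margins put at least two cells
    -- between the children, so their corners differ by at least three.
    have hstep : ∀ e (ω ω' : S.Code), S.corner e ω (n + 1) ≤ S.corner e ω' (n + 1) + 1 →
        S.corner e ω n ≤ S.corner e ω' n := by
      intro e ω ω' hle
      by_contra! hlt
      have h1 := S.digit_add_two_le e n (ω' n)
      have h2 := S.one_le_digit e n (ω n)
      rw [corner, corner] at hle
      nlinarith
    have hcor : ∀ e, S.corner e ω n = S.corner e ω' n := fun e =>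
      le_antisymm (hstep e _ _ (h e).1) (hstep e _ _ (h e).2)
    have hlt := ih fun e => by rw [hcor e]; omega
    intro i hi
    rcases Nat.lt_succ_iff_lt_or_eq.1 hi with hi | rfl
    · exact hlt i hi
    · refine S.label_eq_of_digit_close fun e => ?_
      have := h e
      rw [corner, corner, hcor e] at this
      omega

/-! ### The coding map -/

/-- The coordinates of the point with code `ω`. -/
noncomputable def coord (e : Fin 2) (ω : S.Code) : ℝ :=
  ⨆ n, (S.corner e ω n : ℝ) / 2 ^ S.K n

lemma corner_div_mono (e : Fin 2) (ω : S.Code) :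
    Monotone fun n => (S.corner e ω n : ℝ) / 2 ^ S.K n := by
  refine monotone_nat_of_le_succ fun n => ?_
  rw [S.K_succ, pow_add, div_le_div_iff₀ (by positivity) (by positivity)]
  have : (S.corner e ω n : ℝ) * 2 ^ S.L n ≤ S.corner e ω (n + 1) := by
    rw [corner]; push_cast; linarith [Nat.cast_nonneg (α := ℝ) (S.digit e n (ω n))]
  nlinarith [pow_pos (two_pos (α := ℝ)) (S.K n)]

lemma corner_succ_div_lt (e : Fin 2) (ω : S.Code) (n : ℕ) :
    ((S.corner e ω (n + 1) : ℝ) + 1) / 2 ^ S.K (n + 1) < ((S.corner e ω n : ℝ) + 1) / 2 ^ S.K n := by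
  rw [S.K_succ, pow_add, div_lt_div_iff₀ (by positivity) (by positivity)]
  have h1 : (S.digit e n (ω n) : ℝ) + 2 ≤ 2 ^ S.L n := by
    exact_mod_cast S.digit_add_two_le e n (ω n)
  have : (S.corner e ω (n + 1) : ℝ) + 1 < ((S.corner e ω n : ℝ) + 1) * 2 ^ S.L n := by
    rw [corner]; push_cast; linarith
  nlinarith [pow_pos (two_pos (α := ℝ)) (S.K n)]

lemma corner_div_le_corner_add_one_div (e : Fin 2) (ω : S.Code) (m n : ℕ) :
    (S.corner e ω m : ℝ) / 2 ^ S.K m ≤ ((S.corner e ω n : ℝ) + 1) / 2 ^ S.K n := by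
  have hanti : Antitone fun n => ((S.corner e ω n : ℝ) + 1) / 2 ^ S.K n :=
    antitone_nat_of_succ_le fun n => (S.corner_succ_div_lt e ω n).le
  calc (S.corner e ω m : ℝ) / 2 ^ S.K m
      ≤ (S.corner e ω (max m n) : ℝ) / 2 ^ S.K (max m n) :=
        S.corner_div_mono e ω (le_max_left _ _)
    _ ≤ ((S.corner e ω (max m n) : ℝ) + 1) / 2 ^ S.K (max m n) := by gcongr; linarith
    _ ≤ _ := hanti (le_max_right _ _)

lemma corner_div_le_coord (e : Fin 2) (ω : S.Code) (n : ℕ) :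
    (S.corner e ω n : ℝ) / 2 ^ S.K n ≤ S.coord e ω :=
  le_ciSup (f := fun n => (S.corner e ω n : ℝ) / 2 ^ S.K n)
    ⟨_, Set.forall_mem_range.2 fun m => S.corner_div_le_corner_add_one_div e ω m 0⟩ n

/-- Strict although the coordinate is a supremum: the margin places the stage `n + 1` interval
strictly before the right end. So points lie in their half-open squares. -/
lemma coord_lt (e : Fin 2) (ω : S.Code) (n : ℕ) :
    S.coord e ω < ((S.corner e ω n : ℝ) + 1) / 2 ^ S.K n :=
  (ciSup_le fun m => S.corner_div_le_corner_add_one_div e ω m (n + 1)).trans_lt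
    (S.corner_succ_div_lt e ω n)

lemma continuous_corner (e : Fin 2) (n : ℕ) : Continuous fun ω : S.Code => S.corner e ω n := by
  induction n with
  | zero => exact continuous_const
  | succ n ih =>
    have h : Continuous fun ω : S.Code => S.digit e n (ω n) :=
      (continuous_of_discreteTopology (f := S.digit e n)).comp (continuous_apply n)
    exact (ih.mul continuous_const).add h

/-- Each approximation depends on finitely many labels, and the error is at most `2 ^ (-K n)`
uniformly in the code. -/
lemma continuous_coord (e : Fin 2) : Continuous (S.coord e) := by
  have hlim : TendstoUniformly (fun n (ω : S.Code) => (S.corner e ω n : ℝ) / 2 ^ S.K n)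
      (S.coord e) atTop := by
    rw [Metric.tendstoUniformly_iff]
    intro ε hε
    obtain ⟨m, hm⟩ := exists_pow_lt_of_lt_one hε (by norm_num : (1 / 2 : ℝ) < 1)
    filter_upwards [eventually_ge_atTop m] with n hn ω
    have h1 := S.corner_div_le_coord e ω n
    have h2 := S.coord_lt e ω n
    rw [add_div] at h2
    have h3 : (1 : ℝ) / 2 ^ S.K n ≤ (1 / 2) ^ m := by
      rw [div_pow, one_pow]
      exact one_div_le_one_div_of_le (by positivity)
        (pow_le_pow_right₀ one_le_two (hn.trans (S.le_K n)))
    rw [Real.dist_eq, abs_lt]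
    constructor <;> linarith
  refine hlim.continuous (Frequently.of_forall fun n => ?_)
  exact (continuous_of_discreteTopology (f := fun m : ℕ => (m : ℝ))).comp
    (S.continuous_corner e n) |>.div_const _

/-- The point of the plane with code `ω`. -/
noncomputable def point (ω : S.Code) : Plane := WithLp.toLp 2 fun e => S.coord e ω

@[simp] lemma point_apply (ω : S.Code) (e : Fin 2) : S.point ω e = S.coord e ω := rfl

lemma continuous_point : Continuous S.point :=
  (PiLp.continuous_toLp 2 _).comp (continuous_pi fun e => S.continuous_coord e)

/-! ### Dyadic squares between two stages, in integer terms -/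

/-- The integer position of the dyadic interval of generation `K n + t` containing the coordinate. -/
def index (e : Fin 2) (ω : S.Code) (n t : ℕ) : ℕ :=
  S.corner e ω (n + 1) / 2 ^ (S.L n - t)

lemma index_eq (e : Fin 2) (ω : S.Code) {n t : ℕ} (ht : t ≤ S.L n) :
    S.index e ω n t = S.corner e ω n * 2 ^ t + S.digit e n (ω n) / 2 ^ (S.L n - t) := by
  rw [index, corner, show 2 ^ S.L n = 2 ^ t * 2 ^ (S.L n - t) by rw [← pow_add]; congr 1; omega,
    ← mul_assoc, Nat.add_comm, Nat.add_mul_div_right _ _ (by positivity), Nat.add_comm]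

lemma digit_div_lt (e : Fin 2) {n t : ℕ} (p : S.Label n) (ht : t ≤ S.L n) :
    S.digit e n p / 2 ^ (S.L n - t) < 2 ^ t := by
  rw [Nat.div_lt_iff_lt_mul (by positivity), ← pow_add, show t + (S.L n - t) = S.L n by omega]
  have := S.digit_add_two_le e n p
  omega

/-- The threshold is a multiple of the stage `n + 1` mesh, so it cannot separate the coordinate from
the left end of its half-open interval of that stage. Membership in dyadic squares thus becomes
integer arithmetic. -/
lemma int_mul_le_coord_iff (e : Fin 2) (ω : S.Code) {n t : ℕ} (ht : t ≤ S.L n) (a : ℤ) :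
    (a : ℝ) * (2 : ℝ) ^ (-((S.K n + t : ℕ) : ℤ)) ≤ S.coord e ω ↔ a ≤ S.index e ω n t := by
  have h1 := S.corner_div_le_coord e ω (n + 1)
  have h2 := S.coord_lt e ω (n + 1)
  have hK : S.K (n + 1) = S.K n + t + (S.L n - t) := by rw [S.K_succ]; omega
  rw [div_le_iff₀ (by positivity)] at h1
  rw [lt_div_iff₀ (by positivity)] at h2
  have hpow : ((2 ^ (S.L n - t) : ℕ) : ℝ) = 2 ^ S.K (n + 1) * (2 : ℝ) ^ (-((S.K n + t : ℕ) : ℤ)) := by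
    rw [hK, zpow_neg, zpow_natCast, pow_add 2 (S.K n + t)]
    push_cast
    field_simp
  have h3 : (a : ℝ) * (2 : ℝ) ^ (-((S.K n + t : ℕ) : ℤ)) ≤ S.coord e ω ↔
      (a : ℝ) * ((2 ^ (S.L n - t) : ℕ) : ℝ) ≤ S.coord e ω * 2 ^ S.K (n + 1) := by
    rw [hpow, mul_comm (2 ^ S.K (n + 1) : ℝ), ← mul_assoc]
    exact (mul_le_mul_iff_left₀ (by positivity)).symm
  rw [h3, index]
  push_cast
  rw [Int.le_ediv_iff_mul_le (by positivity)]
  constructor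
  · intro h
    have : ((a * 2 ^ (S.L n - t) : ℤ) : ℝ) < ((S.corner e ω (n + 1) + 1 : ℤ) : ℝ) := by
      push_cast; exact lt_of_le_of_lt (by exact_mod_cast h) h2
    have := Int.cast_lt.1 this
    omega
  · intro h
    have : ((a * 2 ^ (S.L n - t) : ℤ) : ℝ) ≤ ((S.corner e ω (n + 1) : ℤ) : ℝ) := Int.cast_le.2 h
    push_cast at this
    exact this.trans h1

lemma mem_toSet_iff {ω : S.Code} {n t : ℕ} (ht : t ≤ S.L n) {Q : DyadicSquare}
    (hQ : Q.k = ((S.K n + t : ℕ) : ℤ)) :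
    S.point ω ∈ Q.toSet ↔ ∀ e, (S.index e ω n t : ℤ) = Q.corner e := by
  simp only [DyadicSquare.toSet, DyadicSquare.side, hQ, Set.mem_ofPred_eq, Set.mem_Ico, point_apply,
    ← not_le]
  refine forall_congr' fun e => ?_
  have h2 := S.int_mul_le_coord_iff e ω ht (Q.corner e + 1)
  simp only [Int.cast_add, Int.cast_one] at h2
  rw [h2]
  have h1 := S.int_mul_le_coord_iff e ω ht (Q.corner e)
  rw [h1]
  omega

lemma mem_triple_iff {ω : S.Code} {n t : ℕ} (ht : t ≤ S.L n) {Q : DyadicSquare}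
    (hQ : Q.k = ((S.K n + t : ℕ) : ℤ)) :
    S.point ω ∈ Q.triple ↔
      ∀ e, Q.corner e - 1 ≤ S.index e ω n t ∧ (S.index e ω n t : ℤ) ≤ Q.corner e + 1 := by
  simp only [DyadicSquare.triple, DyadicSquare.side, hQ, Set.mem_ofPred_eq, Set.mem_Ico, point_apply,
    ← not_le]
  refine forall_congr' fun e => ?_
  have h2 := S.int_mul_le_coord_iff e ω ht (Q.corner e + 2)
  simp only [Int.cast_add, Int.cast_ofNat] at h2
  rw [h2]
  have h1 := S.int_mul_le_coord_iff e ω ht (Q.corner e - 1)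
  simp only [Int.cast_sub, Int.cast_one] at h1
  rw [h1]
  omega

/-- Points in neighbouring squares of generation between `K n` and `K (n + 1)` lie in the same
square of stage `n`. -/
lemma eq_of_index_close {ω ω' : S.Code} {n t : ℕ} (ht : t ≤ S.L n)
    (h : ∀ e, S.index e ω n t ≤ S.index e ω' n t + 1 ∧ S.index e ω' n t ≤ S.index e ω n t + 1) :
    ∀ i < n, ω i = ω' i := by
  have hstep : ∀ e (ω ω' : S.Code), S.index e ω n t ≤ S.index e ω' n t + 1 →
      S.corner e ω n ≤ S.corner e ω' n + 1 := by
    intro e ω ω' hle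
    by_contra! hlt
    rw [S.index_eq e ω ht, S.index_eq e ω' ht] at hle
    have := S.digit_div_lt e (ω' n) ht
    have h2 : 1 ≤ 2 ^ t := Nat.one_le_two_pow
    have h3 : (S.corner e ω' n + 2) * 2 ^ t ≤ S.corner e ω n * 2 ^ t :=
      Nat.mul_le_mul_right _ hlt
    have h4 := Nat.zero_le (S.digit e n (ω n) / 2 ^ (S.L n - t))
    rw [add_mul] at h3
    linarith
  exact S.eq_of_corner_close fun e => ⟨hstep e _ _ (h e).1, hstep e _ _ (h e).2⟩

/-- Half-open intervals force equal points to have equal corners at every stage. It is needed to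
turn null sets of codes into null sets of the plane. -/
lemma point_injective : Function.Injective S.point := by
  intro ω ω' h
  have hc : ∀ e n, S.corner e ω n ≤ S.corner e ω' n := by
    intro e n
    have h1 := S.corner_div_le_coord e ω n
    have h2 := S.coord_lt e ω' n
    rw [← S.point_apply, ← h, S.point_apply] at h2
    have := h1.trans_lt h2
    rw [div_lt_div_iff_of_pos_right (by positivity)] at this
    exact Nat.lt_succ_iff.1 (by exact_mod_cast this)
  have hc' : ∀ e n, S.corner e ω' n ≤ S.corner e ω n := by
    intro e n
    have h1 := S.corner_div_le_coord e ω' n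
    have h2 := S.coord_lt e ω n
    rw [← S.point_apply, h, S.point_apply] at h2
    have := h1.trans_lt h2
    rw [div_lt_div_iff_of_pos_right (by positivity)] at this
    exact Nat.lt_succ_iff.1 (by exact_mod_cast this)
  funext n
  refine S.eq_of_corner_close (n := n + 1) (fun e => ?_) n n.lt_succ_self
  have := hc e (n + 1)
  have := hc' e (n + 1)
  omega

end Scheme

/-! ### Row weights and the product measure on codes -/

namespace Scheme
variable (S : Scheme)

/-- The mass of a row of a stage `n` square, relative to the mass of the square. -/
noncomputable def rowWeight (n : ℕ) (j : Fin (S.M n + 1)) : ℝ :=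
  if (j : ℕ) = 0 then 1 / (n + 2) else (n + 1) / ((n + 2) * S.M n)

lemma rowWeight_of_eq_zero {n : ℕ} {j : Fin (S.M n + 1)} (h : (j : ℕ) = 0) :
    S.rowWeight n j = 1 / (n + 2) := if_pos h

lemma rowWeight_of_ne_zero {n : ℕ} {j : Fin (S.M n + 1)} (h : (j : ℕ) ≠ 0) :
    S.rowWeight n j = (n + 1) / ((n + 2) * S.M n) := if_neg h

lemma cast_M_pos (n : ℕ) : (0 : ℝ) < S.M n := Nat.cast_pos.2 (S.M_pos n)

lemma one_le_cast_M (n : ℕ) : (1 : ℝ) ≤ S.M n := by exact_mod_cast S.M_pos n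

lemma inv_le_rowWeight (n : ℕ) (j : Fin (S.M n + 1)) :
    1 / (((n : ℝ) + 2) * S.M n) ≤ S.rowWeight n j := by
  have hM := S.one_le_cast_M n
  have hM' := S.cast_M_pos n
  unfold rowWeight
  split_ifs
  · apply one_div_le_one_div_of_le (by positivity)
    nlinarith [Nat.cast_nonneg (α := ℝ) n]
  · gcongr
    linarith [Nat.cast_nonneg (α := ℝ) n]

lemma rowWeight_pos (n : ℕ) (j : Fin (S.M n + 1)) : 0 < S.rowWeight n j :=
  lt_of_lt_of_le (by have := S.cast_M_pos n; positivity) (S.inv_le_rowWeight n j)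

lemma sum_rowWeight (n : ℕ) : ∑ j, S.rowWeight n j = 1 := by
  have hM' := S.cast_M_pos n
  rw [Fin.sum_univ_succ]
  simp only [rowWeight, Fin.val_zero, if_true, Fin.val_succ, Nat.succ_ne_zero, if_false,
    Finset.sum_const, Finset.card_univ, Fintype.card_fin, nsmul_eq_mul]
  field_simp
  ring

noncomputable def rowMeasure (n : ℕ) : Measure (Fin (S.M n + 1)) :=
  ∑ j, ENNReal.ofReal (S.rowWeight n j) • Measure.dirac j

lemma rowMeasure_apply (n : ℕ) (s : Finset (Fin (S.M n + 1))) :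
    S.rowMeasure n s = ENNReal.ofReal (∑ j ∈ s, S.rowWeight n j) := by
  classical
  rw [ENNReal.ofReal_sum_of_nonneg fun j _ => (S.rowWeight_pos n j).le, rowMeasure]
  simp only [Measure.coe_finsetSum, Finset.sum_apply, Measure.smul_apply, smul_eq_mul,
    Measure.dirac_apply, Set.indicator_apply, Finset.mem_coe, Pi.one_apply, mul_ite, mul_one,
    mul_zero]
  rw [Finset.sum_ite_mem, Finset.univ_inter]

instance (n : ℕ) : IsProbabilityMeasure (S.rowMeasure n) :=
  ⟨by rw [← Finset.coe_univ, rowMeasure_apply, sum_rowWeight, ENNReal.ofReal_one]⟩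

noncomputable def labelMeasure (n : ℕ) : Measure (S.Label n) :=
  (ProbabilityTheory.uniformOn Set.univ).prod (S.rowMeasure n)

instance (n : ℕ) : IsProbabilityMeasure
    (ProbabilityTheory.uniformOn (Set.univ : Set (Fin (2 ^ (2 * S.M n + 2))))) :=
  ProbabilityTheory.isProbabilityMeasure_uniformOn Set.finite_univ
    ⟨⟨0, by positivity⟩, trivial⟩

instance (n : ℕ) : IsProbabilityMeasure (S.labelMeasure n) := by
  unfold labelMeasure; infer_instance

lemma labelMeasure_prod (n : ℕ) (I : Finset (Fin (2 ^ (2 * S.M n + 2)))) (j : Fin (S.M n + 1)) :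
    S.labelMeasure n ((I : Set (Fin (2 ^ (2 * S.M n + 2)))) ×ˢ {j}) =
      ENNReal.ofReal (I.card / 2 ^ (2 * S.M n + 2) * S.rowWeight n j) := by
  have hj := S.rowMeasure_apply n {j}
  rw [Finset.coe_singleton, Finset.sum_singleton] at hj
  rw [labelMeasure, Measure.prod_prod, hj, ProbabilityTheory.uniformOn_univ,
    Measure.count_apply_finset, Fintype.card_fin, ENNReal.ofReal_mul (by positivity),
    ENNReal.ofReal_div_of_pos (by positivity)]
  congr 2
  · rw [ENNReal.ofReal_natCast]
  · rw [ENNReal.ofReal_pow (by norm_num)]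
    simp

noncomputable def codeMeasure : Measure S.Code := Measure.infinitePi S.labelMeasure

instance : IsProbabilityMeasure S.codeMeasure := by unfold codeMeasure; infer_instance

/-- The codes of the points of the stage `n` square of `ω`. -/
def cylinder (ω : S.Code) (n : ℕ) : Set S.Code := {ω' | ∀ i < n, ω' i = ω i}

lemma codeMeasure_cylinder (ω : S.Code) (n : ℕ) :
    S.codeMeasure (S.cylinder ω n) = ∏ i ∈ Finset.range n, S.labelMeasure i {ω i} := by
  rw [codeMeasure, ← Measure.infinitePi_pi S.labelMeasure (s := Finset.range n)
    (t := fun i => {ω i}) fun i _ => measurableSet_singleton _]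
  congr 1
  ext ω'
  simp [cylinder, Set.mem_pi]

lemma codeMeasure_cylinder_inter (ω : S.Code) (n : ℕ) (G : Set (S.Label n)) :
    S.codeMeasure (S.cylinder ω n ∩ {ω' | ω' n ∈ G}) =
      S.codeMeasure (S.cylinder ω n) * S.labelMeasure n G := by
  have h : S.cylinder ω n ∩ {ω' | ω' n ∈ G} = Set.pi (Finset.range (n + 1))
      (Function.update (fun i => ({ω i} : Set (S.Label i))) n G) := by
    ext ω'
    simp only [cylinder, Set.mem_inter_iff, Set.mem_ofPred_eq, Set.mem_pi, Finset.coe_range,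
      Set.mem_Iio]
    constructor
    · rintro ⟨h1, h2⟩ i hi
      rcases Nat.lt_succ_iff_lt_or_eq.1 hi with hi | rfl
      · rw [Function.update_of_ne hi.ne]
        exact h1 i hi
      · rwa [Function.update_self]
    · intro h
      refine ⟨fun i hi => ?_, ?_⟩
      · have := h i (by omega)
        rwa [Function.update_of_ne hi.ne] at this
      · have := h n (by omega)
        rwa [Function.update_self] at this
  rw [h, codeMeasure_cylinder, codeMeasure, Measure.infinitePi_pi _ fun i _ => MeasurableSet.of_discrete,
    Finset.prod_range_succ, Function.update_self]
  congr 1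
  refine Finset.prod_congr rfl fun i hi => ?_
  rw [Function.update_of_ne (Finset.mem_range.1 hi).ne]

noncomputable def mass (ω : S.Code) (n : ℕ) : ℝ := (S.codeMeasure (S.cylinder ω n)).toReal

lemma ofReal_mass (ω : S.Code) (n : ℕ) :
    ENNReal.ofReal (S.mass ω n) = S.codeMeasure (S.cylinder ω n) :=
  ENNReal.ofReal_toReal (measure_ne_top _ _)

lemma mass_nonneg (ω : S.Code) (n : ℕ) : 0 ≤ S.mass ω n := ENNReal.toReal_nonneg

lemma mass_le_one (ω : S.Code) (n : ℕ) : S.mass ω n ≤ 1 :=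
  ENNReal.toReal_le_of_le_ofReal zero_le_one (by simpa using prob_le_one)

lemma codeMeasure_cylinder_inter_prod (ω : S.Code) (n : ℕ)
    (I : Finset (Fin (2 ^ (2 * S.M n + 2)))) (j : Fin (S.M n + 1)) :
    S.codeMeasure (S.cylinder ω n ∩ {ω' | (ω' n).1 ∈ I ∧ (ω' n).2 = j}) =
      ENNReal.ofReal (S.mass ω n * (I.card / 2 ^ (2 * S.M n + 2) * S.rowWeight n j)) := by
  rw [ENNReal.ofReal_mul (S.mass_nonneg _ _), ofReal_mass, ← labelMeasure_prod,
    ← codeMeasure_cylinder_inter]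
  congr 2

lemma mass_succ (ω : S.Code) (n : ℕ) :
    S.mass ω (n + 1) = S.mass ω n * (1 / 2 ^ (2 * S.M n + 2) * S.rowWeight n (ω n).2) := by
  have h := S.codeMeasure_cylinder_inter_prod ω n {(ω n).1} (ω n).2
  have hset : S.cylinder ω n ∩ {ω' | (ω' n).1 ∈ ({(ω n).1} : Finset _) ∧ (ω' n).2 = (ω n).2}
      = S.cylinder ω (n + 1) := by
    ext ω'
    simp only [cylinder, Set.mem_inter_iff, Set.mem_ofPred_eq, Finset.mem_singleton]
    constructor
    · rintro ⟨h1, h2⟩ i hi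
      rcases Nat.lt_succ_iff_lt_or_eq.1 hi with hi | rfl
      · exact h1 i hi
      · exact Prod.ext h2.1 h2.2
    · intro h
      exact ⟨fun i hi => h i (by omega), by rw [h n (by omega)], by rw [h n (by omega)]⟩
  have h0 := S.mass_nonneg ω n
  have h1 := (S.rowWeight_pos n (ω n).2).le
  rw [mass, ← hset, h, ENNReal.toReal_ofReal (by positivity)]
  simp

/-- `W_succ` multiplies by the number of positions in a row and by a common upper bound for the
inverse row weights, so `1 / W` is a lower bound for cylinders whatever rows they use. -/
lemma inv_W_le_mass (ω : S.Code) (n : ℕ) : 1 / (S.W n : ℝ) ≤ S.mass ω n := by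
  induction n with
  | zero =>
    have : S.cylinder ω 0 = Set.univ := by ext; simp [cylinder]
    simp [mass, this, S.W_zero]
  | succ n ih =>
    have hW : (0 : ℝ) < S.W n := Nat.cast_pos.2 (S.W_pos n)
    have hM := S.cast_M_pos n
    rw [mass_succ, S.W_succ]
    push_cast
    calc 1 / ((S.W n : ℝ) * (2 ^ (2 * S.M n + 2) * ((n + 2) * S.M n)))
        = 1 / S.W n * (1 / 2 ^ (2 * S.M n + 2) * (1 / ((n + 2) * S.M n))) := by
          field_simp
      _ ≤ _ := by
          gcongr
          · exact S.mass_nonneg ω n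
          · exact S.inv_le_rowWeight n _

lemma mass_pos (ω : S.Code) (n : ℕ) : 0 < S.mass ω n :=
  lt_of_lt_of_le (by have := S.W_pos n; positivity) (S.inv_W_le_mass ω n)

/-! ### Rows at intermediate scales -/

/-- The positions in a row in the same dyadic interval of length `2⁻ᵗ` as `i`. -/
def block {A : ℕ} (t : ℕ) (i : Fin (2 ^ A)) : Finset (Fin (2 ^ A)) :=
  {i' | (i' : ℕ) / 2 ^ (A - t) = i / 2 ^ (A - t)}

/-- The positions in a row in the same or an adjacent dyadic interval of length `2⁻ᵗ` as `i`. -/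
def tripleBlock {A : ℕ} (t : ℕ) (i : Fin (2 ^ A)) : Finset (Fin (2 ^ A)) :=
  {i' | (i' : ℕ) / 2 ^ (A - t) ≤ i / 2 ^ (A - t) + 1 ∧
    (i : ℕ) / 2 ^ (A - t) ≤ i' / 2 ^ (A - t) + 1}

lemma le_card_block {A t : ℕ} (ht : t ≤ A) (i : Fin (2 ^ A)) : 2 ^ (A - t) ≤ (block t i).card := by
  have hpos : 0 < 2 ^ (A - t) := by positivity
  have hA : 2 ^ A = 2 ^ t * 2 ^ (A - t) := by rw [← pow_add]; congr 1; omega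
  have hlt : (i : ℕ) / 2 ^ (A - t) + 1 ≤ 2 ^ t := by
    rw [Nat.succ_le_iff, Nat.div_lt_iff_lt_mul hpos, ← hA]
    exact i.2
  have hf : ∀ s : Fin (2 ^ (A - t)), (i : ℕ) / 2 ^ (A - t) * 2 ^ (A - t) + s < 2 ^ A := by
    intro s
    have := s.2
    exact lt_of_lt_of_eq (by nlinarith) hA.symm
  have := Finset.card_le_card_of_injOn (s := (Finset.univ : Finset (Fin (2 ^ (A - t)))))
    (t := block t i) (fun s => ⟨_, hf s⟩)
    (fun s _ => by
      simp only [block, Finset.coe_filter, Finset.mem_univ, true_and, Set.mem_ofPred_eq]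
      rw [Nat.add_comm, Nat.add_mul_div_right _ _ hpos, Nat.div_eq_of_lt s.2, zero_add])
    (fun s _ s' _ h => by
      simp only [Fin.mk.injEq] at h
      exact Fin.ext (by omega))
  simpa using this

lemma card_tripleBlock_le {A t : ℕ} (i : Fin (2 ^ A)) :
    (tripleBlock t i).card ≤ 3 * 2 ^ (A - t) := by
  have hpos : 0 < 2 ^ (A - t) := by positivity
  set b := (i : ℕ) / 2 ^ (A - t) with hb
  have := Finset.card_le_card_of_injOn (s := tripleBlock t i)
    -- For `b = 0` the truncated subtraction gives `0`, and three blocks from there still cover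
    -- blocks `0` and `1`.
    (t := Finset.Ico ((b - 1) * 2 ^ (A - t)) ((b - 1) * 2 ^ (A - t) + 3 * 2 ^ (A - t)))
    (fun i' => (i' : ℕ))
    (fun i' hi' => by
      simp only [tripleBlock, Finset.coe_filter, Finset.mem_univ, true_and,
        Set.mem_ofPred_eq, ← hb] at hi'
      simp only [Finset.coe_Ico, Set.mem_Ico]
      rw [← Nat.le_div_iff_mul_le hpos, ← add_mul, ← Nat.div_lt_iff_lt_mul hpos]
      generalize (i' : ℕ) / 2 ^ (A - t) = c at hi' ⊢
      omega)
    (fun s _ s' _ h => Fin.ext h)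
  simpa using this

/-- The offset `1` is smaller than the spacing of a row and disappears in the floor, so down to the
scale of the spacing only the position label matters. -/
lemma digit_zero_div {n t : ℕ} (ht : t ≤ 2 * S.M n + 2) (p : S.Label n) :
    S.digit 0 n p / 2 ^ (S.L n - t) = p.1 / 2 ^ (2 * S.M n + 2 - t) := by
  have hL := S.two_mul_add_four_le n
  have h2 : 1 < 2 ^ (S.L n - (2 * S.M n + 2)) := Nat.one_lt_two_pow (by omega)
  have hexp : 2 ^ (S.L n - t) = 2 ^ (S.L n - (2 * S.M n + 2)) * 2 ^ (2 * S.M n + 2 - t) := by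
    rw [← pow_add]; congr 1; omega
  rw [digit_zero, hexp, ← Nat.div_div_eq_div_mul, Nat.add_comm, Nat.add_mul_div_right _ _ (by positivity),
    Nat.div_eq_of_lt h2, zero_add]

lemma digit_one_div_of_eq_zero {n t : ℕ} (ht : t < S.L n) {p : S.Label n} (hp : (p.2 : ℕ) = 0) :
    S.digit 1 n p / 2 ^ (S.L n - t) = 0 := by
  rw [digit_one, if_pos hp]
  exact Nat.div_eq_of_lt (Nat.one_lt_two_pow (by omega))

lemma digit_one_div_of_lt {n t : ℕ} (ht : t < S.L n) {p : S.Label n} (hp : t < 2 * (p.2 : ℕ)) :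
    S.digit 1 n p / 2 ^ (S.L n - t) = 0 := by
  have hL := S.two_mul_add_four_le n
  rw [digit_one, if_neg (by omega)]
  exact Nat.div_eq_of_lt (Nat.pow_lt_pow_right one_lt_two (by omega))

/-- This is the height `4 ^ (-j)` in units of `2 ^ (-t)`. At `t = 2 * j` the row occupies the square
just above that of the main row; for larger `t` at least one square lies between them. -/
lemma digit_one_div_of_le {n t : ℕ} (ht : t ≤ S.L n) {p : S.Label n} (h0 : (p.2 : ℕ) ≠ 0)
    (hp : 2 * (p.2 : ℕ) ≤ t) :
    S.digit 1 n p / 2 ^ (S.L n - t) = 2 ^ (t - 2 * p.2) := by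
  rw [digit_one, if_neg h0, Nat.pow_div (by omega) two_pos]
  congr 1
  omega

/-! ### The measure and its support -/

/-- The measure of the theorem. -/
noncomputable def measure : Measure Plane := S.codeMeasure.map S.point

lemma measurable_point : Measurable S.point := S.continuous_point.measurable

instance : IsProbabilityMeasure S.measure :=
  Measure.isProbabilityMeasure_map S.measurable_point.aemeasurable

lemma measure_apply {s : Set Plane} (hs : MeasurableSet s) :
    S.measure s = S.codeMeasure (S.point ⁻¹' s) := Measure.map_apply S.measurable_point hs

/-- The code space is compact, so the range of the coding map is closed; having full measure, it
contains the support. -/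
lemma exists_of_mem_support {x : Plane} (hx : x ∈ S.measure.support) : ∃ ω, S.point ω = x := by
  have hc : IsCompact (Set.range S.point) := isCompact_range S.continuous_point
  refine Measure.support_subset_of_isClosed hc.isClosed ?_ hx
  rw [mem_ae_iff, S.measure_apply hc.isClosed.measurableSet.compl]
  convert measure_empty (μ := S.codeMeasure)
  ext ω
  simp

lemma coord_nonneg (e : Fin 2) (ω : S.Code) : 0 ≤ S.coord e ω := by
  simpa [corner] using S.corner_div_le_coord e ω 0

lemma coord_lt_inv (e : Fin 2) (ω : S.Code) : S.coord e ω < 1 / 2 ^ S.K 0 := by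
  simpa [corner] using S.coord_lt e ω 0

lemma support_subset : S.measure.support ⊆ unitSquare := by
  intro x hx e
  obtain ⟨ω, rfl⟩ := S.exists_of_mem_support hx
  refine ⟨S.coord_nonneg e ω, (S.coord_lt_inv e ω).le.trans ?_⟩
  rw [div_le_one (by positivity)]
  exact one_le_pow₀ one_le_two

end Scheme

/-! ### Bounding `β` by a horizontal line -/

namespace DyadicSquare

lemma side_pos (Q : DyadicSquare) : 0 < Q.side := by unfold side; positivity

lemma measurableSet_setOf_forall_mem {s : Fin 2 → Set ℝ} (hs : ∀ i, MeasurableSet (s i)) :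
    MeasurableSet {x : Plane | ∀ i, x i ∈ s i} := by
  have : {x : Plane | ∀ i, x i ∈ s i} = ⋂ i, (fun x : Plane => x i) ⁻¹' s i := by
    ext; simp
  rw [this]
  exact MeasurableSet.iInter fun i =>
    (EuclideanSpace.proj (𝕜 := ℝ) i).continuous.measurable (hs i)

lemma measurableSet_toSet (Q : DyadicSquare) : MeasurableSet Q.toSet :=
  measurableSet_setOf_forall_mem fun _ => measurableSet_Ico

lemma measurableSet_triple (Q : DyadicSquare) : MeasurableSet Q.triple :=
  measurableSet_setOf_forall_mem fun _ => measurableSet_Ico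

lemma side_le_ediam_triple (Q : DyadicSquare) :
    ENNReal.ofReal Q.side ≤ Metric.ediam Q.triple := by
  have hs := Q.side_pos
  let x : ℝ → Plane := fun a => WithLp.toLp 2 fun i =>
    if i = 0 then ((Q.corner i : ℝ) + a) * Q.side else (Q.corner i : ℝ) * Q.side
  have hx : ∀ a ∈ Set.Icc (0 : ℝ) 1, x a ∈ Q.triple := by
    intro a ha i
    simp only [x]
    split_ifs
    · constructor <;> nlinarith [ha.1, ha.2]
    · constructor <;> nlinarith
  refine le_trans ?_ (Metric.edist_le_ediam_of_mem (hx 1 (by simp)) (hx 0 (by simp)))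
  rw [edist_dist, EuclideanSpace.dist_eq]
  apply ENNReal.ofReal_le_ofReal
  simp [x, Real.dist_eq, add_mul, Real.sqrt_sq hs.le]

end DyadicSquare

/-- A square has `β` number at most its mean deviation from any given horizontal line. -/
lemma beta2_sq_le (μ : Measure Plane) (Q : DyadicSquare) (h : ℝ) :
    beta2 μ Q.triple ^ 2 ≤ (μ Q.triple)⁻¹ *
      ∫⁻ y in Q.triple, ENNReal.ofReal (((y 1 - h) / Q.side) ^ 2) ∂μ := by
  let v : Plane := EuclideanSpace.single 0 1
  let L : AffineSubspace ℝ Plane := AffineSubspace.mk' (EuclideanSpace.single 1 h) (ℝ ∙ v)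
  have hL : Module.finrank ℝ L.direction = 1 := by
    rw [AffineSubspace.direction_mk']
    exact finrank_span_singleton (by simp [v])
  have hdist : ∀ y : Plane, Metric.infEDist y (L : Set Plane) ≤ ENNReal.ofReal |y 1 - h| := by
    intro y
    have hmem : (EuclideanSpace.single 1 h + y 0 • v : Plane) ∈ (L : Set Plane) := by
      have := AffineSubspace.vadd_mem_mk' (EuclideanSpace.single 1 h : Plane)
        (Submodule.smul_mem (ℝ ∙ v) (y 0) (Submodule.mem_span_singleton_self v))
      rwa [vadd_eq_add, add_comm] at this
    refine (Metric.infEDist_le_edist_of_mem hmem).trans ?_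
    rw [edist_dist, EuclideanSpace.dist_eq]
    apply ENNReal.ofReal_le_ofReal
    simp [v, Real.dist_eq, Real.sqrt_sq_eq_abs]
  have h1 : beta2 μ Q.triple ≤ ((μ Q.triple)⁻¹ * ∫⁻ y in Q.triple,
      (Metric.infEDist y (L : Set Plane) / Metric.ediam Q.triple) ^ 2 ∂μ) ^ (1 / 2 : ℝ) :=
    iInf₂_le L hL
  calc beta2 μ Q.triple ^ 2 ≤ (((μ Q.triple)⁻¹ * ∫⁻ y in Q.triple,
      (Metric.infEDist y (L : Set Plane) / Metric.ediam Q.triple) ^ 2 ∂μ) ^ (1 / 2 : ℝ)) ^ 2 := by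
        gcongr
    _ = (μ Q.triple)⁻¹ * ∫⁻ y in Q.triple,
      (Metric.infEDist y (L : Set Plane) / Metric.ediam Q.triple) ^ 2 ∂μ := by
        rw [← ENNReal.rpow_natCast, ← ENNReal.rpow_mul]
        norm_num
    _ ≤ _ := by
        gcongr with y
        calc (Metric.infEDist y (L : Set Plane) / Metric.ediam Q.triple) ^ 2
            ≤ (ENNReal.ofReal |y 1 - h| / ENNReal.ofReal Q.side) ^ 2 := by
              gcongr
              · exact hdist y
              · exact Q.side_le_ediam_triple
          _ = ENNReal.ofReal (((y 1 - h) / Q.side) ^ 2) := by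
              rw [← ENNReal.ofReal_div_of_pos Q.side_pos, ← ENNReal.ofReal_pow (by
                have := Q.side_pos; positivity), div_pow, sq_abs, div_pow]

/-! ### Which rows a tripled square meets -/

namespace Scheme
variable (S : Scheme)

section Geometry

variable {S} {ω ω' : S.Code} {n t : ℕ} {Q : DyadicSquare}

lemma side_eq (hQ : Q.k = ((S.K n + t : ℕ) : ℤ)) : Q.side = 1 / 2 ^ (S.K n + t) := by
  rw [DyadicSquare.side, hQ, zpow_neg, zpow_natCast, one_div]

/-- Since stage `n` squares are not adjacent, a tripled square of finer generation around a point
sees only one of them, and only the labels at stage `n` remain to be compared. -/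
lemma mem_cylinder_of_mem_triple (ht : t ≤ S.L n) (hQ : Q.k = ((S.K n + t : ℕ) : ℤ))
    (hω : S.point ω ∈ Q.toSet) (hω' : S.point ω' ∈ Q.triple) :
    ω' ∈ S.cylinder ω n ∧ ∀ e,
      S.digit e n (ω' n) / 2 ^ (S.L n - t) ≤ S.digit e n (ω n) / 2 ^ (S.L n - t) + 1 ∧
      S.digit e n (ω n) / 2 ^ (S.L n - t) ≤ S.digit e n (ω' n) / 2 ^ (S.L n - t) + 1 := by
  rw [S.mem_toSet_iff ht hQ] at hω
  rw [S.mem_triple_iff ht hQ] at hω'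
  have hclose : ∀ e, S.index e ω' n t ≤ S.index e ω n t + 1 ∧
      S.index e ω n t ≤ S.index e ω' n t + 1 := by
    intro e
    have := hω e
    have := hω' e
    omega
  have hcyl := S.eq_of_index_close ht hclose
  refine ⟨hcyl, fun e => ?_⟩
  have := hclose e
  rw [S.index_eq e ω ht, S.index_eq e ω' ht, S.corner_congr hcyl] at this
  constructor <;> linarith [this.1, this.2]

lemma mem_toSet_of_digit_eq (ht : t ≤ S.L n) (hQ : Q.k = ((S.K n + t : ℕ) : ℤ))
    (hω : S.point ω ∈ Q.toSet) (hcyl : ω' ∈ S.cylinder ω n)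
    (h : ∀ e, S.digit e n (ω' n) / 2 ^ (S.L n - t) = S.digit e n (ω n) / 2 ^ (S.L n - t)) :
    S.point ω' ∈ Q.toSet := by
  rw [S.mem_toSet_iff ht hQ] at hω ⊢
  intro e
  rw [← hω e, S.index_eq e ω' ht, S.index_eq e ω ht, S.corner_congr hcyl, h e]

lemma mem_triple_of_digit_close (ht : t ≤ S.L n) (hQ : Q.k = ((S.K n + t : ℕ) : ℤ))
    (hω : S.point ω ∈ Q.toSet) (hcyl : ω' ∈ S.cylinder ω n)
    (h : ∀ e, S.digit e n (ω' n) / 2 ^ (S.L n - t) ≤ S.digit e n (ω n) / 2 ^ (S.L n - t) + 1 ∧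
      S.digit e n (ω n) / 2 ^ (S.L n - t) ≤ S.digit e n (ω' n) / 2 ^ (S.L n - t) + 1) :
    S.point ω' ∈ Q.triple := by
  rw [S.mem_toSet_iff ht hQ] at hω
  rw [S.mem_triple_iff ht hQ]
  intro e
  have h1 := S.index_eq e ω' ht
  rw [S.corner_congr hcyl] at h1
  have h2 := S.index_eq e ω ht
  have := h e
  have := hω e
  omega

/-- The row of `p` is the only one meeting a tripled square of relative generation `t` around it. -/
def Isolated (t : ℕ) (p : S.Label n) : Prop :=
  ((p.2 : ℕ) ≠ 0 ∧ 2 * (p.2 : ℕ) < t) ∨ ((p.2 : ℕ) = 0 ∧ 2 * S.M n < t)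

/-- The floor of the height of an isolated low row is at least `2`, while consecutive low rows
differ in height by a factor four and the main row has floor `0`. So the floors of distinct rows
differ by at least two. If the isolated row is the main one, all low rows already have floor at
least `2`. -/
lemma Isolated.row_eq {p p' : S.Label n} (h : Isolated t p) (ht : t < S.L n)
    (hd : S.digit 1 n p' / 2 ^ (S.L n - t) ≤ S.digit 1 n p / 2 ^ (S.L n - t) + 1 ∧
      S.digit 1 n p / 2 ^ (S.L n - t) ≤ S.digit 1 n p' / 2 ^ (S.L n - t) + 1) :
    p'.2 = p.2 := by
  have hp' := p'.2.2
  refine Fin.ext ?_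
  have hfour : ∀ a b : ℕ, 2 * a < 2 * b → 2 * b ≤ t → 2 ^ (t - 2 * b) * 4 ≤ 2 ^ (t - 2 * a) := by
    intro a b hab hb
    calc 2 ^ (t - 2 * b) * 4 = 2 ^ (t - 2 * b + 2) := by rw [pow_add]; rfl
      _ ≤ _ := Nat.pow_le_pow_right two_pos (by omega)
  have hone : ∀ a, 1 ≤ 2 ^ a := fun a => Nat.one_le_two_pow
  have htwo : ∀ a, a < t → 2 ≤ 2 ^ (t - a) := fun a ha => by
    calc 2 = 2 ^ 1 := rfl
      _ ≤ _ := Nat.pow_le_pow_right two_pos (by omega)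
  rcases h with ⟨h0, hlt⟩ | ⟨h0, hlt⟩
  · rw [S.digit_one_div_of_le ht.le h0 hlt.le] at hd
    have h2 := htwo _ hlt
    rcases eq_or_ne (p'.2 : ℕ) 0 with h0' | h0'
    · rw [S.digit_one_div_of_eq_zero ht h0'] at hd
      omega
    · rcases lt_or_ge t (2 * (p'.2 : ℕ)) with hlt' | hle'
      · rw [S.digit_one_div_of_lt ht hlt'] at hd
        omega
      · rw [S.digit_one_div_of_le ht.le h0' hle'] at hd
        have h1 := hone (t - 2 * (p'.2 : ℕ))
        rcases lt_trichotomy (p'.2 : ℕ) p.2 with h | h | h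
        · have := hfour p'.2 p.2 (by omega) hlt.le
          omega
        · exact h
        · have := hfour p.2 p'.2 (by omega) hle'
          omega
  · rw [S.digit_one_div_of_eq_zero ht h0] at hd
    by_contra hne
    have h0' : (p'.2 : ℕ) ≠ 0 := by omega
    rw [S.digit_one_div_of_le ht.le h0' (by omega)] at hd
    have := htwo (2 * (p'.2 : ℕ)) (by omega)
    omega

lemma digit_one_div_le_one {p : S.Label n} (h : ¬ Isolated t p) (ht : t < S.L n) :
    S.digit 1 n p / 2 ^ (S.L n - t) ≤ 1 := by
  simp only [Isolated] at h
  rcases eq_or_ne (p.2 : ℕ) 0 with h0 | h0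
  · rw [S.digit_one_div_of_eq_zero ht h0]
    omega
  · rcases Nat.lt_or_eq_of_le (show t ≤ 2 * (p.2 : ℕ) by omega) with hlt | heq
    · rw [S.digit_one_div_of_lt ht hlt]
      omega
    · rw [S.digit_one_div_of_le ht.le h0 heq.ge, heq]
      simp

lemma le_of_not_isolated {p : S.Label n} (h : ¬ Isolated t p) : t ≤ 2 * S.M n := by
  have := p.2.2
  simp only [Isolated] at h
  omega

/-- A low row with `2 * j < t` has floor at least `2`, out of reach from floor `0`. From floor `1`,
which occurs only for `t = 2 * j₀`, parity gives a floor of at least `4`. So all low rows met have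
height at most the side of the square. -/
lemma le_two_mul_row {p p' : S.Label n} (h : ¬ Isolated t p) (ht : t < S.L n)
    (hd : S.digit 1 n p' / 2 ^ (S.L n - t) ≤ S.digit 1 n p / 2 ^ (S.L n - t) + 1)
    (h0 : (p'.2 : ℕ) ≠ 0) : t ≤ 2 * (p'.2 : ℕ) := by
  by_contra! hlt
  have h1 := digit_one_div_le_one h ht
  rw [S.digit_one_div_of_le ht.le h0 hlt.le] at hd
  rcases eq_or_ne (p.2 : ℕ) 0 with hp0 | hp0
  · rw [S.digit_one_div_of_eq_zero ht hp0] at hd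
    have : 2 ^ 1 ≤ 2 ^ (t - 2 * (p'.2 : ℕ)) := Nat.pow_le_pow_right two_pos (by omega)
    omega
  · simp only [Isolated] at h
    rcases Nat.lt_or_eq_of_le (show t ≤ 2 * (p.2 : ℕ) by omega) with hlt' | heq
    · rw [S.digit_one_div_of_lt ht hlt'] at hd
      have : 2 ^ 1 ≤ 2 ^ (t - 2 * (p'.2 : ℕ)) := Nat.pow_le_pow_right two_pos (by omega)
      omega
    · have : 2 ^ 2 ≤ 2 ^ (t - 2 * (p'.2 : ℕ)) := Nat.pow_le_pow_right two_pos (by omega)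
      omega

lemma coord_sub_mem (e : Fin 2) (hcyl : ω' ∈ S.cylinder ω n) :
    (S.digit e n (ω' n) : ℝ) / 2 ^ S.K (n + 1) ≤
      S.coord e ω' - S.corner e ω n / 2 ^ S.K n ∧
    S.coord e ω' - S.corner e ω n / 2 ^ S.K n ≤
      ((S.digit e n (ω' n) : ℝ) + 1) / 2 ^ S.K (n + 1) := by
  have h1 := S.corner_div_le_coord e ω' (n + 1)
  have h2 := (S.coord_lt e ω' (n + 1)).le
  rw [Scheme.corner, S.corner_congr hcyl] at h1 h2
  have h3 : (S.corner e ω n : ℝ) / 2 ^ S.K n =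
      S.corner e ω n * 2 ^ S.L n / 2 ^ S.K (n + 1) := by
    rw [S.K_succ, pow_add]
    field_simp
  push_cast at h1 h2
  rw [h3]
  rw [add_div] at h1
  rw [add_assoc, add_div] at h2
  constructor <;> linarith

end Geometry

/-! ### Masses of squares and tripled squares -/

section Masses

variable {S} {ω : S.Code} {n t : ℕ} {Q : DyadicSquare}

lemma ofReal_le_codeMeasure_block (ht : t ≤ 2 * S.M n + 2) (ω : S.Code) (j : Fin (S.M n + 1)) :
    ENNReal.ofReal (S.mass ω n * (1 / 2 ^ t * S.rowWeight n j)) ≤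
      S.codeMeasure (S.cylinder ω n ∩ {ω' | (ω' n).1 ∈ block t (ω n).1 ∧ (ω' n).2 = j}) := by
  rw [codeMeasure_cylinder_inter_prod]
  apply ENNReal.ofReal_le_ofReal
  have h := le_card_block ht (ω n).1
  have h' : ((2 : ℝ) ^ (2 * S.M n + 2 - t)) ≤ (block t (ω n).1).card := by exact_mod_cast h
  have hr := S.rowWeight_pos n j
  have hm := S.mass_nonneg ω n
  refine mul_le_mul_of_nonneg_left (mul_le_mul_of_nonneg_right ?_ hr.le) hm
  rw [div_le_div_iff₀ (by positivity) (by positivity), one_mul]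
  calc (2 : ℝ) ^ (2 * S.M n + 2) = 2 ^ (2 * S.M n + 2 - t) * 2 ^ t := by
        rw [← pow_add]; congr 1; omega
    _ ≤ _ := by gcongr

/-- A square carries at least the mass of the part of a row that it contains. -/
lemma ofReal_le_measure_toSet (htA : t ≤ 2 * S.M n + 2) (ht : t < S.L n)
    (hQ : Q.k = ((S.K n + t : ℕ) : ℤ)) (hω : S.point ω ∈ Q.toSet) (j : Fin (S.M n + 1))
    (hj : ∀ p' : S.Label n, p'.2 = j →
      S.digit 1 n p' / 2 ^ (S.L n - t) = S.digit 1 n (ω n) / 2 ^ (S.L n - t)) :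
    ENNReal.ofReal (S.mass ω n * (1 / 2 ^ t * S.rowWeight n j)) ≤ S.measure Q.toSet := by
  rw [S.measure_apply Q.measurableSet_toSet]
  refine (ofReal_le_codeMeasure_block htA ω j).trans (measure_mono ?_)
  rintro ω' ⟨hcyl, h1, h2⟩
  refine mem_toSet_of_digit_eq ht.le hQ hω hcyl fun e => ?_
  fin_cases e
  · change S.digit 0 n _ / _ = S.digit 0 n _ / _
    rw [S.digit_zero_div htA, S.digit_zero_div htA]
    simpa [block] using h1
  · exact hj _ h2

lemma inv_W_succ_le_measure_toSet (ht : t ≤ S.L n) (hQ : Q.k = ((S.K n + t : ℕ) : ℤ))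
    (hω : S.point ω ∈ Q.toSet) : ENNReal.ofReal (1 / S.W (n + 1)) ≤ S.measure Q.toSet := by
  rw [S.measure_apply Q.measurableSet_toSet]
  refine (ENNReal.ofReal_le_ofReal (S.inv_W_le_mass ω (n + 1))).trans ?_
  rw [ofReal_mass]
  refine measure_mono fun ω' hω' => ?_
  exact mem_toSet_of_digit_eq ht hQ hω (fun i hi => hω' i (by omega)) fun e => by
    rw [hω' n n.lt_succ_self]

/-- A non-isolated row has floor at most `1`, so the triple reaches down to the main row. This main
row mass is the denominator of `β`. -/
lemma ofReal_le_measure_triple (htA : t ≤ 2 * S.M n + 2) (ht : t < S.L n)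
    (hQ : Q.k = ((S.K n + t : ℕ) : ℤ)) (hω : S.point ω ∈ Q.toSet)
    (h : ¬ Isolated t (ω n)) :
    ENNReal.ofReal (S.mass ω n * (1 / 2 ^ t * (1 / (n + 2)))) ≤ S.measure Q.triple := by
  have h0 : ((0 : Fin (S.M n + 1)) : ℕ) = 0 := rfl
  rw [S.measure_apply Q.measurableSet_triple, ← S.rowWeight_of_eq_zero h0]
  refine (ofReal_le_codeMeasure_block htA ω 0).trans (measure_mono ?_)
  rintro ω' ⟨hcyl, h1, h2⟩
  refine mem_triple_of_digit_close ht.le hQ hω hcyl fun e => ?_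
  fin_cases e
  · change S.digit 0 n _ / _ ≤ S.digit 0 n _ / _ + 1 ∧ S.digit 0 n _ / _ ≤ S.digit 0 n _ / _ + 1
    rw [S.digit_zero_div htA, S.digit_zero_div htA]
    have : ((ω' n).1 : ℕ) / 2 ^ (2 * S.M n + 2 - t) = (ω n).1 / 2 ^ (2 * S.M n + 2 - t) := by
      simpa [block] using h1
    omega
  · change S.digit 1 n _ / _ ≤ S.digit 1 n _ / _ + 1 ∧ S.digit 1 n _ / _ ≤ S.digit 1 n _ / _ + 1
    have h3 : ((ω' n).2 : ℕ) = 0 := by rw [h2]; rfl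
    have := digit_one_div_le_one h ht
    rw [S.digit_one_div_of_eq_zero ht h3]
    exact ⟨Nat.zero_le _, by simpa using this⟩

/-- A tripled square meets at most three dyadic intervals of a row. This controls both the numerator
of `β` and the mass of small balls. -/
lemma codeMeasure_row_inter_le (htA : t ≤ 2 * S.M n + 2) (ht : t < S.L n)
    (hQ : Q.k = ((S.K n + t : ℕ) : ℤ)) (hω : S.point ω ∈ Q.toSet) (j : Fin (S.M n + 1)) :
    S.codeMeasure ({ω' | (ω' n).2 = j} ∩ S.point ⁻¹' Q.triple) ≤
      ENNReal.ofReal (S.mass ω n * (3 / 2 ^ t * S.rowWeight n j)) := by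
  have hsub : {ω' | (ω' n).2 = j} ∩ S.point ⁻¹' Q.triple ⊆
      S.cylinder ω n ∩ {ω' | (ω' n).1 ∈ tripleBlock t (ω n).1 ∧ (ω' n).2 = j} := by
    rintro ω' ⟨hj, hω'⟩
    obtain ⟨hcyl, hd⟩ := mem_cylinder_of_mem_triple ht.le hQ hω hω'
    refine ⟨hcyl, ?_, hj⟩
    have := hd 0
    rw [S.digit_zero_div htA, S.digit_zero_div htA] at this
    simpa [tripleBlock] using this
  refine (measure_mono hsub).trans ?_
  rw [codeMeasure_cylinder_inter_prod]
  apply ENNReal.ofReal_le_ofReal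
  have h' : ((tripleBlock t (ω n).1).card : ℝ) ≤ 3 * 2 ^ (2 * S.M n + 2 - t) := by
    exact_mod_cast card_tripleBlock_le (t := t) (ω n).1
  have hr := S.rowWeight_pos n j
  have hm := S.mass_nonneg ω n
  refine mul_le_mul_of_nonneg_left (mul_le_mul_of_nonneg_right ?_ hr.le) hm
  rw [div_le_div_iff₀ (by positivity) (by positivity)]
  calc _ ≤ (3 * 2 ^ (2 * S.M n + 2 - t) : ℝ) * 2 ^ t := by gcongr
    _ = 3 * 2 ^ (2 * S.M n + 2) := by rw [mul_assoc, ← pow_add]; congr 2; omega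

end Masses

/-! ### Bounds for the `β` numbers -/

section Beta

variable {S} {ω : S.Code} {n t : ℕ} {Q : DyadicSquare}

lemma beta2_measure_sq_le (Q : DyadicSquare) (h : ℝ) :
    beta2 S.measure Q.triple ^ 2 ≤ (S.measure Q.triple)⁻¹ *
      ∫⁻ ω in S.point ⁻¹' Q.triple,
        ENNReal.ofReal (((S.coord 1 ω - h) / Q.side) ^ 2) ∂S.codeMeasure := by
  refine (beta2_sq_le S.measure Q h).trans (le_of_eq ?_)
  have hmeas : Measurable fun y : Plane => ENNReal.ofReal (((y 1 - h) / Q.side) ^ 2) := by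
    have : Measurable fun y : Plane => y 1 :=
      (EuclideanSpace.proj (𝕜 := ℝ) (1 : Fin 2)).continuous.measurable
    fun_prop
  rw [measure, setLIntegral_map Q.measurableSet_triple hmeas S.measurable_point]
  rfl

/-- If the part of the support in the tripled square lies in a strip, the `β` number is small. -/
lemma beta2_sq_le_of_flat {h σ : ℝ}
    (hflat : ∀ ω, S.point ω ∈ Q.triple → |S.coord 1 ω - h| ≤ σ) :
    beta2 S.measure Q.triple ^ 2 ≤ ENNReal.ofReal ((σ / Q.side) ^ 2) := by
  have hs := Q.side_pos
  refine (beta2_measure_sq_le Q h).trans ?_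
  have hmeas : MeasurableSet (S.point ⁻¹' Q.triple) := S.measurable_point Q.measurableSet_triple
  calc _ ≤ (S.measure Q.triple)⁻¹ * ∫⁻ _ in S.point ⁻¹' Q.triple,
        ENNReal.ofReal ((σ / Q.side) ^ 2) ∂S.codeMeasure := by
        refine mul_le_mul_right (setLIntegral_mono' hmeas fun ω hω =>
          ENNReal.ofReal_le_ofReal ?_) _
        rw [div_pow, div_pow, ← sq_abs (S.coord 1 ω - h)]
        have := hflat ω hω
        gcongr
    _ = (S.measure Q.triple)⁻¹ * S.measure Q.triple * ENNReal.ofReal ((σ / Q.side) ^ 2) := by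
        rw [setLIntegral_const, ← S.measure_apply Q.measurableSet_triple]
        ring
    _ ≤ 1 * ENNReal.ofReal ((σ / Q.side) ^ 2) := by
        gcongr
        exact ENNReal.inv_mul_le_one _
    _ = _ := one_mul _

/-- Only one row is visible, and it lies in a strip as thin as one child. -/
lemma beta2_sq_le_of_isolated (ht : t < S.L n) (hQ : Q.k = ((S.K n + t : ℕ) : ℤ))
    (hω : S.point ω ∈ Q.toSet) (h : Isolated t (ω n)) :
    beta2 S.measure Q.triple ^ 2 ≤ ENNReal.ofReal ((2 ^ t / 2 ^ S.L n) ^ 2) := by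
  have hflat := beta2_sq_le_of_flat (S := S) (Q := Q) (σ := 1 / 2 ^ S.K (n + 1))
    (h := S.corner 1 ω n / 2 ^ S.K n + S.digit 1 n (ω n) / 2 ^ S.K (n + 1)) ?_
  · refine hflat.trans (le_of_eq ?_)
    rw [side_eq hQ, S.K_succ, pow_add, pow_add]
    congr 2
    field_simp
  · intro ω' hω'
    obtain ⟨hcyl, hd⟩ := mem_cylinder_of_mem_triple ht.le hQ hω hω'
    have hrow := h.row_eq ht (hd 1)
    have hdig : S.digit 1 n (ω' n) = S.digit 1 n (ω n) := by
      rw [S.digit_one, S.digit_one, hrow]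
    have := coord_sub_mem 1 hcyl
    rw [hdig, add_div] at this
    rw [abs_le]
    have hpos : (0 : ℝ) < 1 / 2 ^ S.K (n + 1) := by positivity
    constructor <;> linarith [this.1, this.2]

lemma sum_row_heights_le (M t : ℕ) :
    ∑ j ∈ Finset.univ.filter (fun j : Fin (M + 1) => t ≤ 2 * (j : ℕ)), (4 : ℝ) * 4 ^ t / 16 ^ (j : ℕ) ≤ 5 := by
  -- `s` is `t / 2` rounded up, the first row index in the sum; the geometric series of ratio `1 /
  -- 16` then gives `4 * 16 / 15 ≤ 5`.
  set s := (t + 1) / 2 with hs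
  have h4 : (4 : ℝ) ^ t ≤ 16 ^ s := by
    rw [show (16 : ℝ) = 4 ^ 2 by norm_num, ← pow_mul]
    exact pow_le_pow_right₀ (by norm_num) (by omega)
  have hgeom := geom_sum_Ico_le_of_lt_one (x := (1 / 16 : ℝ)) (m := s) (n := M + 1)
    (by norm_num) (by norm_num)
  have h1 : ∑ j ∈ Finset.univ.filter (fun j : Fin (M + 1) => t ≤ 2 * (j : ℕ)), (4 : ℝ) * 4 ^ t / 16 ^ (j : ℕ) =
      ∑ j ∈ (Finset.range (M + 1)).filter (fun j => t ≤ 2 * j), (4 : ℝ) * 4 ^ t / 16 ^ j := by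
    rw [Finset.sum_filter, Finset.sum_filter,
      Finset.sum_range fun j => if t ≤ 2 * j then (4 : ℝ) * 4 ^ t / 16 ^ j else 0]
  have h2 : (Finset.range (M + 1)).filter (fun j => t ≤ 2 * j) = Finset.Ico s (M + 1) := by
    ext j
    simp only [Finset.mem_filter, Finset.mem_range, Finset.mem_Ico]
    omega
  rw [h1, h2]
  calc ∑ j ∈ Finset.Ico s (M + 1), (4 : ℝ) * 4 ^ t / 16 ^ j
      = 4 * 4 ^ t * ∑ j ∈ Finset.Ico s (M + 1), (1 / 16 : ℝ) ^ j := by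
        rw [Finset.mul_sum]
        refine Finset.sum_congr rfl fun j _ => ?_
        rw [div_pow, one_pow, mul_one_div]
    _ ≤ 4 * 16 ^ s * ((1 / 16) ^ s / (1 - 1 / 16)) := by gcongr
    _ ≤ 5 := by
        rw [div_pow, one_pow]
        field_simp
        norm_num

/-- The deviation of the rows near the main row from the bottom line of the stage `n` square. -/
lemma coord_deviation_le (hQ : Q.k = ((S.K n + t : ℕ) : ℤ))
    {ω' : S.Code} (hcyl : ω' ∈ S.cylinder ω n) :
    ((S.coord 1 ω' - S.corner 1 ω n / 2 ^ S.K n) / Q.side) ^ 2 ≤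
      if ((ω' n).2 : ℕ) = 0 then 4 * (2 ^ t / 2 ^ S.L n) ^ 2
      else 4 * 4 ^ t / 16 ^ ((ω' n).2 : ℕ) := by
  have hs := Q.side_pos
  obtain ⟨h1, h2⟩ := coord_sub_mem 1 hcyl
  have h0 : 0 ≤ S.coord 1 ω' - S.corner 1 ω n / 2 ^ S.K n := le_trans (by positivity) h1
  have h3 : (S.coord 1 ω' - S.corner 1 ω n / 2 ^ S.K n) / Q.side ≤
      ((S.digit 1 n (ω' n) : ℝ) + 1) * 2 ^ t / 2 ^ S.L n := by
    calc _ ≤ (((S.digit 1 n (ω' n) : ℝ) + 1) / 2 ^ S.K (n + 1)) / Q.side := by gcongr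
      _ = _ := by
        rw [side_eq hQ, S.K_succ, pow_add, pow_add]
        field_simp
  have h4 := pow_le_pow_left₀ (by positivity) h3 2
  refine h4.trans ?_
  rw [S.digit_one]
  split_ifs with hj
  · apply le_of_eq
    push_cast
    ring
  · have hL := S.two_mul_add_four_le n
    have hj' := (ω' n).2.2
    have hle : ((2 ^ (S.L n - 2 * ((ω' n).2 : ℕ)) : ℕ) : ℝ) + 1 ≤
        2 * (2 ^ S.L n / 4 ^ ((ω' n).2 : ℕ)) := by
      have he : (2 : ℝ) ^ S.L n / 4 ^ ((ω' n).2 : ℕ) = 2 ^ (S.L n - 2 * ((ω' n).2 : ℕ)) := by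
        rw [show (4 : ℝ) = 2 ^ 2 by norm_num, ← pow_mul, pow_sub₀ _ two_ne_zero (by omega)]
        rfl
      rw [he]
      push_cast
      have : (1 : ℝ) ≤ 2 ^ (S.L n - 2 * ((ω' n).2 : ℕ)) := one_le_pow₀ one_le_two
      linarith
    calc _ ≤ (2 * (2 ^ S.L n / 4 ^ ((ω' n).2 : ℕ)) * 2 ^ t / (2 : ℝ) ^ S.L n) ^ 2 := by gcongr
      _ = 4 * 4 ^ t / 16 ^ ((ω' n).2 : ℕ) := by
        have h16 : (16 : ℝ) ^ ((ω' n).2 : ℕ) = (4 ^ ((ω' n).2 : ℕ)) ^ 2 := by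
          rw [← pow_mul, pow_mul', show (4 : ℝ) ^ 2 = 16 by norm_num]
        have h4t : (4 : ℝ) ^ t = (2 ^ t) ^ 2 := by
          rw [← pow_mul, pow_mul', show (2 : ℝ) ^ 2 = 4 by norm_num]
        rw [h16, h4t]
        field_simp
        norm_num

/-- The comparison line is the bottom of the stage `n` square. The main row deviates only by the
width of a child. Each low row has `(n + 1) / M n` times the mass of the main row, and `15` is `3`
intervals of a row times the bound `5` for the sum of squared heights. -/
lemma beta2_sq_le_of_not_isolated (ht : t < S.L n) (hQ : Q.k = ((S.K n + t : ℕ) : ℤ))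
    (hω : S.point ω ∈ Q.toSet) (h : ¬ Isolated t (ω n)) :
    beta2 S.measure Q.triple ^ 2 ≤
      ENNReal.ofReal (4 * (2 ^ t / 2 ^ S.L n) ^ 2 + 15 * (n + 1) / S.M n) := by
  have htA : t ≤ 2 * S.M n + 2 := (le_of_not_isolated h).trans (Nat.le_add_right _ _)
  have hM := S.cast_M_pos n
  have hm := S.mass_pos ω n
  set J : Finset (Fin (S.M n + 1)) := {j | t ≤ 2 * (j : ℕ)} with hJ
  set τ : Fin (S.M n + 1) → ℝ := fun j => if (j : ℕ) = 0 then 0 else 4 * 4 ^ t / 16 ^ (j : ℕ) with hτ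
  have hτ0 : ∀ j, 0 ≤ τ j := fun j => by simp only [hτ]; split_ifs <;> positivity
  have hmeas : MeasurableSet (S.point ⁻¹' Q.triple) := S.measurable_point Q.measurableSet_triple
  have hB : ∀ j, MeasurableSet {ω' : S.Code | (ω' n).2 = j} := fun j =>
    (measurable_pi_apply n) (MeasurableSet.of_discrete (s := {p : S.Label n | p.2 = j}))
  set η : ℝ := (n + 1) / ((n + 2) * S.M n) with hη
  have hη0 : 0 < η := by positivity
  set a : ℝ := 4 * (2 ^ t / 2 ^ S.L n) ^ 2 with ha
  have hpt : ∀ ω' ∈ S.point ⁻¹' Q.triple,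
      ENNReal.ofReal (((S.coord 1 ω' - S.corner 1 ω n / 2 ^ S.K n) / Q.side) ^ 2) ≤
      ENNReal.ofReal a + ∑ j ∈ J, {ω' : S.Code | (ω' n).2 = j}.indicator
        (fun _ => ENNReal.ofReal (τ j)) ω' := by
    intro ω' hω'
    obtain ⟨hcyl, hd⟩ := mem_cylinder_of_mem_triple ht.le hQ hω hω'
    refine (ENNReal.ofReal_le_ofReal (coord_deviation_le hQ hcyl)).trans ?_
    split_ifs with hj
    · exact le_self_add
    · refine le_trans ?_ le_add_self
      have hmem : (ω' n).2 ∈ J := by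
        simp only [hJ, Finset.mem_filter, Finset.mem_univ, true_and]
        exact le_two_mul_row h ht (hd 1).1 hj
      refine le_trans (le_of_eq ?_) (Finset.single_le_sum
        (f := fun j => {ω' : S.Code | (ω' n).2 = j}.indicator
          (fun _ => ENNReal.ofReal (τ j)) ω') (fun _ _ => zero_le) hmem)
      simp only [hτ, if_neg hj]
      rw [Set.indicator_of_mem (show ω' ∈ {ω'' : S.Code | (ω'' n).2 = (ω' n).2} from rfl)]
  have hint : ∫⁻ ω' in S.point ⁻¹' Q.triple,
      ENNReal.ofReal (((S.coord 1 ω' - S.corner 1 ω n / 2 ^ S.K n) / Q.side) ^ 2) ∂S.codeMeasure ≤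
      ENNReal.ofReal a * S.measure Q.triple +
        ENNReal.ofReal (S.mass ω n * (3 / 2 ^ t * η) * 5) := by
    refine (setLIntegral_mono' hmeas hpt).trans ?_
    rw [lintegral_add_left measurable_const, setLIntegral_const,
      ← S.measure_apply Q.measurableSet_triple]
    gcongr
    rw [lintegral_finsetSum _ fun j _ => measurable_const.indicator (hB j)]
    calc _ ≤ ∑ j ∈ J, ENNReal.ofReal (τ j * (S.mass ω n * (3 / 2 ^ t * η))) := by
          refine Finset.sum_le_sum fun j _ => ?_
          rw [lintegral_indicator_const (hB j), Measure.restrict_apply (hB j),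
            ENNReal.ofReal_mul (hτ0 j)]
          rcases eq_or_ne (j : ℕ) 0 with hj | hj
          · simp only [hτ, if_pos hj, ENNReal.ofReal_zero, zero_mul, le_refl]
          · gcongr
            have := codeMeasure_row_inter_le htA ht hQ hω j
            rwa [S.rowWeight_of_ne_zero hj] at this
      _ = ENNReal.ofReal ((∑ j ∈ J, τ j) * (S.mass ω n * (3 / 2 ^ t * η))) := by
          rw [Finset.sum_mul, ENNReal.ofReal_sum_of_nonneg]
          intro j _
          have := hτ0 j
          positivity
      _ ≤ _ := by
          apply ENNReal.ofReal_le_ofReal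
          rw [mul_comm]
          refine mul_le_mul_of_nonneg_left ?_ (by positivity)
          refine le_trans (Finset.sum_le_sum fun j _ => ?_) (sum_row_heights_le (S.M n) t)
          simp only [hτ]
          split_ifs
          · positivity
          · exact le_rfl
  have htri := ofReal_le_measure_triple htA ht hQ hω h
  have htri0 : S.measure Q.triple ≠ 0 := by
    refine ne_of_gt (lt_of_lt_of_le ?_ htri)
    rw [ENNReal.ofReal_pos]
    positivity
  calc beta2 S.measure Q.triple ^ 2
      ≤ (S.measure Q.triple)⁻¹ * (ENNReal.ofReal a * S.measure Q.triple +
        ENNReal.ofReal (S.mass ω n * (3 / 2 ^ t * η) * 5)) := by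
        refine (beta2_measure_sq_le Q (S.corner 1 ω n / 2 ^ S.K n)).trans ?_
        gcongr
    _ = ENNReal.ofReal a + (S.measure Q.triple)⁻¹ *
          ENNReal.ofReal (S.mass ω n * (3 / 2 ^ t * η) * 5) := by
        rw [mul_add, mul_comm (ENNReal.ofReal a), ← mul_assoc,
          ENNReal.inv_mul_cancel htri0 (measure_ne_top _ _), one_mul]
    _ ≤ ENNReal.ofReal a + (ENNReal.ofReal (S.mass ω n * (1 / 2 ^ t * (1 / (n + 2)))))⁻¹ *
          ENNReal.ofReal (S.mass ω n * (3 / 2 ^ t * η) * 5) := by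
        gcongr
    _ = _ := by
        rw [← ENNReal.ofReal_inv_of_pos (by positivity), ← ENNReal.ofReal_mul (by positivity),
          ← ENNReal.ofReal_add (by positivity) (by positivity)]
        congr 2
        rw [hη]
        field_simp
        norm_num

end Beta

end Scheme

/-! ### Summing the square function -/

/-- The summand of the square function belonging to a square. -/
noncomputable def jonesTerm (μ : Measure Plane) (Q : DyadicSquare) : ℝ≥0∞ :=
  beta2 μ Q.triple ^ 2 * (ENNReal.ofReal Q.side / μ Q.toSet)

lemma jonesTerm_le {μ : Measure Plane} {Q : DyadicSquare} {b u : ℝ}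
    (hb : beta2 μ Q.triple ^ 2 ≤ ENNReal.ofReal b) (hb0 : 0 ≤ b)
    (hu : ENNReal.ofReal u ≤ μ Q.toSet) (hu0 : 0 < u) :
    jonesTerm μ Q ≤ ENNReal.ofReal (b * (Q.side / u)) := by
  rw [ENNReal.ofReal_mul hb0, ENNReal.ofReal_div_of_pos hu0]
  unfold jonesTerm
  gcongr

namespace DyadicSquare

lemma mem_toSet_iff_floor {Q : DyadicSquare} {x : Plane} :
    x ∈ Q.toSet ↔ ∀ i, ⌊x i / Q.side⌋ = Q.corner i := by
  refine forall_congr' fun i => ?_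
  rw [Int.floor_eq_iff, le_div_iff₀ Q.side_pos, div_lt_iff₀ Q.side_pos]
  rfl

/-- The dyadic square of generation `k` containing `x`. -/
noncomputable def around (x : Plane) (k : ℕ) : DyadicSquare :=
  ⟨k, fun i => ⌊x i / (2 : ℝ) ^ (-(k : ℤ))⌋⟩

lemma mem_around (x : Plane) (k : ℕ) : x ∈ (around x k).toSet :=
  mem_toSet_iff_floor.2 fun _ => rfl

lemma side_around (x : Plane) (k : ℕ) : (around x k).side = 1 / 2 ^ k := by
  simp [side, around]

lemma side_around_le_one (x : Plane) (k : ℕ) : (around x k).side ≤ 1 := by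
  rw [side_around, div_le_one (by positivity)]
  exact one_le_pow₀ one_le_two

lemma exists_eq_around {Q : DyadicSquare} (hQ : Q.side ≤ 1) {x : Plane} (hx : x ∈ Q.toSet) :
    ∃ k, around x k = Q := by
  have hk : 0 ≤ Q.k := by
    by_contra! h
    have : (1 : ℝ) < (2 : ℝ) ^ (-Q.k) := one_lt_zpow₀ one_lt_two (by omega)
    exact absurd hQ (not_le.2 this)
  obtain ⟨k, hk⟩ := Int.eq_ofNat_of_zero_le hk
  refine ⟨k, ?_⟩
  have hfloor := mem_toSet_iff_floor.1 hx
  obtain ⟨k', c⟩ := Q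
  simp only at hk
  subst hk
  simp only [around, mk.injEq, true_and]
  funext i
  exact hfloor i

end DyadicSquare

lemma jonesSquare_eq_tsum (μ : Measure Plane) (x : Plane) :
    jonesSquare μ x = ∑' k : ℕ, jonesTerm μ (DyadicSquare.around x k) := by
  let g : ℕ → {Q : DyadicSquare // Q.side ≤ 1} := fun k =>
    ⟨DyadicSquare.around x k, DyadicSquare.side_around_le_one x k⟩
  have hg : Function.Injective g := fun k k' h => by
    have h1 := congrArg (fun Q : {Q : DyadicSquare // Q.side ≤ 1} => Q.1.k) h
    exact Int.ofNat.inj h1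
  rw [jonesSquare, ← hg.tsum_eq]
  · refine tsum_congr fun k => ?_
    rw [Set.indicator_of_mem (DyadicSquare.mem_around x k)]
    rfl
  · intro Q hQ
    rw [Function.mem_support] at hQ
    obtain ⟨k, hk⟩ := DyadicSquare.exists_eq_around Q.2 (Set.mem_of_indicator_ne_zero hQ)
    exact ⟨k, Subtype.ext hk⟩

namespace Scheme
variable (S : Scheme)

/-- A bound for the contribution of the square of generation `K n + t` around a point in row `j`:
the contribution of the deviation from the main row, and that of the width of the rows. -/
noncomputable def cost (n t j : ℕ) : ℝ :=
  ((if t ≤ 2 * S.M n then 15 * ((n : ℝ) + 2) ^ 2 / S.M n else 0) +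
    (if t = 2 * j then 15 * ((n : ℝ) + 2) else 0)) * (S.W n / 2 ^ S.K n) +
  4 * 2 ^ t / 2 ^ S.L n * (S.W (n + 1) / 2 ^ S.K (n + 1))

lemma cast_W_pos (n : ℕ) : (0 : ℝ) < S.W n := Nat.cast_pos.2 (S.W_pos n)

lemma main_cost_nonneg (n t j : ℕ) :
    0 ≤ ((if t ≤ 2 * S.M n then 15 * ((n : ℝ) + 2) ^ 2 / S.M n else 0) +
      (if t = 2 * j then 15 * ((n : ℝ) + 2) else 0)) * (S.W n / 2 ^ S.K n) := by
  have := S.cast_M_pos n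
  refine mul_nonneg (add_nonneg ?_ ?_) (by positivity)
  · split_ifs <;> positivity
  · split_ifs <;> positivity

lemma cost_nonneg (n t j : ℕ) : 0 ≤ S.cost n t j :=
  add_nonneg (S.main_cost_nonneg n t j) (by positivity)

variable {S} in
lemma jonesTerm_le_cost {ω : S.Code} {n t : ℕ} {Q : DyadicSquare} (ht : t < S.L n)
    (hQ : Q.k = ((S.K n + t : ℕ) : ℤ)) (hω : S.point ω ∈ Q.toSet) :
    jonesTerm S.measure Q ≤ ENNReal.ofReal (S.cost n t (ω n).2) := by
  have hM := S.cast_M_pos n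
  have hM1 := S.one_le_cast_M n
  have hW := S.cast_W_pos n
  have hW' := S.cast_W_pos (n + 1)
  have hn : (0 : ℝ) ≤ n := Nat.cast_nonneg n
  by_cases h : Isolated t (ω n)
  · refine (jonesTerm_le (beta2_sq_le_of_isolated ht hQ hω h) (by positivity)
      (S.inv_W_succ_le_measure_toSet ht.le hQ hω) (by positivity)).trans
      (ENNReal.ofReal_le_ofReal ?_)
    have h1 := S.main_cost_nonneg n t (ω n).2
    have h2 : ((2 : ℝ) ^ t / 2 ^ S.L n) ^ 2 * (Q.side / (1 / S.W (n + 1))) =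
        2 ^ t / 2 ^ S.L n * (S.W (n + 1) / 2 ^ S.K (n + 1)) := by
      rw [side_eq hQ, S.K_succ, pow_add, pow_add]
      field_simp
    have h3 : 0 ≤ (2 : ℝ) ^ t / 2 ^ S.L n * (S.W (n + 1) / 2 ^ S.K (n + 1)) := by positivity
    have h4 : 4 * (2 : ℝ) ^ t / 2 ^ S.L n * (S.W (n + 1) / 2 ^ S.K (n + 1)) =
        4 * (2 ^ t / 2 ^ S.L n * (S.W (n + 1) / 2 ^ S.K (n + 1))) := by ring
    rw [h2, cost, h4]
    linarith
  · have htM := le_of_not_isolated h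
    have htA : t ≤ 2 * S.M n + 2 := by omega
    have hm := S.mass_pos ω n
    have hmW := S.inv_W_le_mass ω n
    -- Row `j` supplies the lower bound for the mass of `Q`: the main row whenever `Q` contains it,
    -- and otherwise the row of the point itself, which happens only for `t = 2 * (ω n).2`.
    obtain ⟨j, hj, hq⟩ : ∃ j : Fin (S.M n + 1),
        (∀ p' : S.Label n, p'.2 = j →
          S.digit 1 n p' / 2 ^ (S.L n - t) = S.digit 1 n (ω n) / 2 ^ (S.L n - t)) ∧
        15 * ((n : ℝ) + 1) / (S.M n * S.rowWeight n j) ≤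
          15 * ((n : ℝ) + 2) ^ 2 / S.M n +
            (if t = 2 * ((ω n).2 : ℕ) then 15 * ((n : ℝ) + 2) else 0) := by
      by_cases hrow : ((ω n).2 : ℕ) = 0 ∨ t < 2 * ((ω n).2 : ℕ)
      · refine ⟨0, fun p' hp' => ?_, ?_⟩
        · rw [S.digit_one_div_of_eq_zero ht (by rw [hp']; rfl)]
          rcases hrow with h0 | h0
          · rw [S.digit_one_div_of_eq_zero ht h0]
          · rw [S.digit_one_div_of_lt ht h0]
        · rw [S.rowWeight_of_eq_zero rfl]
          have h1 : 15 * ((n : ℝ) + 1) / (S.M n * (1 / (n + 2))) ≤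
              15 * ((n : ℝ) + 2) ^ 2 / S.M n := by
            rw [div_le_div_iff₀ (by positivity) hM]
            field_simp
            nlinarith
          refine h1.trans (le_add_of_nonneg_right ?_)
          split_ifs <;> positivity
      · have hrow' : ((ω n).2 : ℕ) ≠ 0 ∧ t = 2 * ((ω n).2 : ℕ) := by
          simp only [Isolated] at h
          omega
        refine ⟨(ω n).2, fun p' hp' => by rw [S.digit_one, S.digit_one, hp'], ?_⟩
        rw [S.rowWeight_of_ne_zero hrow'.1, if_pos hrow'.2]
        have h1 : 15 * ((n : ℝ) + 1) / (S.M n * ((n + 1) / ((n + 2) * S.M n))) =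
            15 * ((n : ℝ) + 2) := by
          field_simp
        rw [h1]
        exact le_add_of_nonneg_left (by positivity)
    have hr := S.rowWeight_pos n j
    refine (jonesTerm_le (beta2_sq_le_of_not_isolated ht hQ hω h) (by positivity)
      (S.ofReal_le_measure_toSet htA ht hQ hω j hj) (by positivity)).trans
      (ENNReal.ofReal_le_ofReal ?_)
    have hside : Q.side / (S.mass ω n * (1 / 2 ^ t * S.rowWeight n j)) =
        1 / (2 ^ S.K n * (S.mass ω n * S.rowWeight n j)) := by
      rw [side_eq hQ, pow_add]
      field_simp
    have hmass : 1 / (2 ^ S.K n * S.mass ω n) ≤ S.W n / 2 ^ S.K n := by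
      rw [div_le_div_iff₀ (by positivity) (by positivity)]
      rw [div_le_iff₀ hW] at hmW
      nlinarith [pow_pos (two_pos (α := ℝ)) (S.K n)]
    have hflat : 4 * ((2 : ℝ) ^ t / 2 ^ S.L n) ^ 2 *
        (1 / (2 ^ S.K n * (S.mass ω n * S.rowWeight n j))) ≤
        4 * 2 ^ t / 2 ^ S.L n * (S.W (n + 1) / 2 ^ S.K (n + 1)) := by
      have h1 : (1 : ℝ) / S.W (n + 1) ≤ S.mass ω n * S.rowWeight n j / 2 ^ t := by
        rw [S.W_succ]
        push_cast
        have h2 : (2 : ℝ) ^ t ≤ 2 ^ (2 * S.M n + 2) := pow_le_pow_right₀ one_le_two htA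
        calc 1 / ((S.W n : ℝ) * (2 ^ (2 * S.M n + 2) * ((n + 2) * S.M n)))
            = 1 / S.W n * (1 / ((n + 2) * S.M n)) / 2 ^ (2 * S.M n + 2) := by
              field_simp
          _ ≤ _ := by
              gcongr
              exact S.inv_le_rowWeight n j
      have h3 : 1 / (S.mass ω n * S.rowWeight n j) ≤ S.W (n + 1) / 2 ^ t := by
        rw [div_le_div_iff₀ hW' (by positivity)] at h1
        rw [div_le_div_iff₀ (by positivity) (by positivity)]
        linarith
      calc 4 * ((2 : ℝ) ^ t / 2 ^ S.L n) ^ 2 *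
          (1 / (2 ^ S.K n * (S.mass ω n * S.rowWeight n j)))
          = 4 * ((2 : ℝ) ^ t / 2 ^ S.L n) ^ 2 / 2 ^ S.K n *
            (1 / (S.mass ω n * S.rowWeight n j)) := by
            field_simp
        _ ≤ 4 * ((2 : ℝ) ^ t / 2 ^ S.L n) ^ 2 / 2 ^ S.K n * (S.W (n + 1) / 2 ^ t) := by gcongr
        _ = _ := by
            rw [S.K_succ, pow_add]
            field_simp
    rw [hside, add_mul, add_comm, cost, if_pos htM]
    refine add_le_add ?_ hflat
    calc 15 * ((n : ℝ) + 1) / S.M n * (1 / (2 ^ S.K n * (S.mass ω n * S.rowWeight n j)))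
        = 15 * ((n : ℝ) + 1) / (S.M n * S.rowWeight n j) * (1 / (2 ^ S.K n * S.mass ω n)) := by
          field_simp
      _ ≤ _ := mul_le_mul hq hmass (by positivity) (le_trans (by positivity) hq)

lemma W_div_le (n : ℕ) (hN : 0 < S.N) :
    (S.W n : ℝ) / 2 ^ S.K n ≤ 1 / (S.N * ((n + 2) ^ 2 * 2 ^ n)) := by
  have hN' : (0 : ℝ) < S.N := Nat.cast_pos.2 hN
  have h : (S.N : ℝ) * (((n : ℝ) + 2) ^ 2 * 2 ^ n) * S.W n ≤ 2 ^ S.K n := by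
    exact_mod_cast S.density n
  rw [div_le_div_iff₀ (by positivity) (by positivity)]
  linarith

/-- The `2 * M n + 1 ≤ 3 * M n` scales near the main row cancel `1 / M n`, the exceptional scale
occurs at most once, and the width terms are geometric. In total `64 = 45 + 15 + 4`; `W_div_le`
absorbs the factor `(n + 2) ^ 2`. -/
lemma sum_cost_le (n j : ℕ) (hN : 0 < S.N) :
    ∑ t ∈ Finset.range (S.L n), S.cost n t j ≤ 64 / (S.N * 2 ^ n) := by
  have hN' : (0 : ℝ) < S.N := Nat.cast_pos.2 hN
  have hM := S.cast_M_pos n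
  have hM1 := S.one_le_cast_M n
  have hL := S.two_mul_add_four_le n
  have hn : (0 : ℝ) ≤ n := Nat.cast_nonneg n
  have h1 : ∑ t ∈ Finset.range (S.L n),
      (if t ≤ 2 * S.M n then 15 * ((n : ℝ) + 2) ^ 2 / S.M n else 0) ≤ 45 * ((n : ℝ) + 2) ^ 2 := by
    have hset : (Finset.range (S.L n)).filter (fun t => t ≤ 2 * S.M n) =
        Finset.range (2 * S.M n + 1) := by
      ext t
      simp only [Finset.mem_filter, Finset.mem_range]
      omega
    rw [← Finset.sum_filter, hset, Finset.sum_const, Finset.card_range, nsmul_eq_mul, ← mul_div_assoc,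
      div_le_iff₀ hM]
    push_cast
    nlinarith [sq_nonneg ((n : ℝ) + 2)]
  have h2 : ∑ t ∈ Finset.range (S.L n), (if t = 2 * j then 15 * ((n : ℝ) + 2) else 0) ≤
      15 * ((n : ℝ) + 2) := by
    rw [Finset.sum_ite_eq']
    split_ifs
    · exact le_rfl
    · positivity
  have h3 : ∑ t ∈ Finset.range (S.L n),
      4 * (2 : ℝ) ^ t / 2 ^ S.L n * (S.W (n + 1) / 2 ^ S.K (n + 1)) ≤
      4 * (S.W (n + 1) / 2 ^ S.K (n + 1)) := by
    have hW := S.cast_W_pos (n + 1)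
    rw [← Finset.sum_mul, ← Finset.sum_div, ← Finset.mul_sum, geom_sum_eq (by norm_num)]
    gcongr
    rw [div_le_iff₀ (by positivity)]
    norm_num
  have h4 := S.W_div_le n hN
  have h5 := S.W_div_le (n + 1) hN
  have h6 : (1 : ℝ) / (S.N * (((n + 1 : ℕ) + 2) ^ 2 * 2 ^ (n + 1))) ≤ 1 / (S.N * 2 ^ n) := by
    apply one_div_le_one_div_of_le (by positivity)
    refine mul_le_mul_of_nonneg_left ?_ hN'.le
    calc (2 : ℝ) ^ n ≤ 2 ^ (n + 1) := pow_le_pow_right₀ one_le_two n.le_succ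
      _ ≤ _ := le_mul_of_one_le_left (by positivity)
        (one_le_pow₀ (by push_cast; linarith))
  have hW := S.cast_W_pos n
  simp only [cost]
  rw [Finset.sum_add_distrib, ← Finset.sum_mul, Finset.sum_add_distrib]
  calc _ ≤ (45 * ((n : ℝ) + 2) ^ 2 + 15 * ((n : ℝ) + 2)) * (S.W n / 2 ^ S.K n) +
        4 * (S.W (n + 1) / 2 ^ S.K (n + 1)) := by gcongr
    _ ≤ 60 * ((n : ℝ) + 2) ^ 2 * (1 / (S.N * ((n + 2) ^ 2 * 2 ^ n))) +
        4 * (1 / (S.N * 2 ^ n)) := by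
        refine add_le_add (mul_le_mul ?_ h4 (by positivity) (by positivity)) ?_
        · nlinarith
        · linarith
    _ = 64 / (S.N * 2 ^ n) := by
        field_simp
        norm_num

variable {S} in
/-- The squares larger than the initial one contain the whole support. -/
lemma jonesTerm_around_le_of_lt {ω : S.Code} {k : ℕ} (hk : k < S.K 0) :
    jonesTerm S.measure (DyadicSquare.around (S.point ω) k) ≤
      ENNReal.ofReal (2 ^ k / (2 ^ S.K 0) ^ 2) := by
  set Q := DyadicSquare.around (S.point ω) k with hQ
  have hs : Q.side = 1 / 2 ^ k := DyadicSquare.side_around _ k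
  have hfloor : ∀ (ω' : S.Code) i, ⌊S.coord i ω' / Q.side⌋ = 0 := by
    intro ω' i
    have h0 := S.coord_nonneg i ω'
    have h1 := S.coord_lt_inv i ω'
    rw [Int.floor_eq_zero_iff, hs]
    refine ⟨by positivity, ?_⟩
    rw [div_lt_one (by positivity)]
    refine h1.trans_le (one_div_le_one_div_of_le (by positivity) ?_)
    exact pow_le_pow_right₀ one_le_two hk.le
  have hcorner : ∀ i, Q.corner i = 0 := fun i => hfloor ω i
  have hmeas : S.measure Q.toSet = 1 := by
    rw [S.measure_apply Q.measurableSet_toSet]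
    convert measure_univ (μ := S.codeMeasure)
    refine Set.eq_univ_of_forall fun ω' => ?_
    exact DyadicSquare.mem_toSet_iff_floor.2 fun i => (hfloor ω' i).trans (hcorner i).symm
  have hflat := beta2_sq_le_of_flat (S := S) (Q := Q) (h := 0) (σ := 1 / 2 ^ S.K 0)
    fun ω' _ => by
      rw [sub_zero, abs_of_nonneg (S.coord_nonneg 1 ω')]
      exact (S.coord_lt_inv 1 ω').le
  refine (jonesTerm_le hflat (by positivity) (u := 1) (by simp [hmeas]) one_pos).trans
    (ENNReal.ofReal_le_ofReal (le_of_eq ?_))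
  rw [hs]
  field_simp

/-- The scales above stage `0` cost at most `1 / N`, and stage `i` costs `64 / (N * 2 ^ i)`; the
closed form of the partial geometric sum lets the induction close. -/
lemma sum_jonesTerm_le (ω : S.Code) (hN : 0 < S.N) (m : ℕ) :
    ∑ k ∈ Finset.range (S.K m), jonesTerm S.measure (DyadicSquare.around (S.point ω) k) ≤
      ENNReal.ofReal (1 / S.N + 64 / S.N * (2 * (1 - 1 / 2 ^ m))) := by
  have hN' : (0 : ℝ) < S.N := Nat.cast_pos.2 hN
  induction m with
  | zero =>
    calc _ ≤ ∑ k ∈ Finset.range (S.K 0), ENNReal.ofReal (2 ^ k / (2 ^ S.K 0) ^ 2) :=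
          Finset.sum_le_sum fun k hk => jonesTerm_around_le_of_lt (Finset.mem_range.1 hk)
      _ ≤ _ := by
          rw [← ENNReal.ofReal_sum_of_nonneg fun k _ => by positivity]
          apply ENNReal.ofReal_le_ofReal
          have h1 := S.W_div_le 0 hN
          rw [S.W_zero] at h1
          have h2 : ∑ k ∈ Finset.range (S.K 0), (2 : ℝ) ^ k / (2 ^ S.K 0) ^ 2 ≤ 1 / 2 ^ S.K 0 := by
            rw [← Finset.sum_div, geom_sum_eq (by norm_num),
              div_le_div_iff₀ (by positivity) (by positivity)]
            nlinarith [pow_pos (two_pos (α := ℝ)) (S.K 0)]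
          have h3 : (1 : ℝ) / (S.N * (((0 : ℕ) + 2) ^ 2 * 2 ^ 0)) ≤ 1 / S.N := by
            apply one_div_le_one_div_of_le hN'
            norm_num
            linarith
          simp only [Nat.cast_one] at h1
          simp only [pow_zero, div_one, sub_self, mul_zero, add_zero]
          exact h2.trans (h1.trans (by simpa using h3))
  | succ m ih =>
    rw [S.K_succ, Finset.sum_range_add]
    calc _ ≤ ENNReal.ofReal (1 / S.N + 64 / S.N * (2 * (1 - 1 / 2 ^ m))) +
          ∑ t ∈ Finset.range (S.L m), ENNReal.ofReal (S.cost m t (ω m).2) := by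
          refine add_le_add ih (Finset.sum_le_sum fun t ht => ?_)
          exact jonesTerm_le_cost (Finset.mem_range.1 ht) rfl (DyadicSquare.mem_around _ _)
      _ ≤ ENNReal.ofReal (1 / S.N + 64 / S.N * (2 * (1 - 1 / 2 ^ m))) +
          ENNReal.ofReal (64 / (S.N * 2 ^ m)) := by
          rw [← ENNReal.ofReal_sum_of_nonneg fun t _ => S.cost_nonneg m t _]
          gcongr
          exact S.sum_cost_le m _ hN
      _ = _ := by
          have : (1 : ℝ) / 2 ^ m ≤ 1 := by
            rw [div_le_one (by positivity)]
            exact one_le_pow₀ one_le_two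
          rw [← ENNReal.ofReal_add
            (add_nonneg (by positivity) (mul_nonneg (by positivity) (by linarith))) (by positivity)]
          congr 1
          rw [pow_succ]
          field_simp
          ring

theorem jonesSquare_le (ω : S.Code) (hN : 0 < S.N) :
    jonesSquare S.measure (S.point ω) ≤ ENNReal.ofReal (129 / S.N) := by
  have hN' : (0 : ℝ) < S.N := Nat.cast_pos.2 hN
  rw [jonesSquare_eq_tsum, ENNReal.tsum_eq_iSup_nat]
  refine iSup_le fun m => ?_
  calc _ ≤ ∑ k ∈ Finset.range (S.K m), jonesTerm S.measure (DyadicSquare.around (S.point ω) k) :=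
        Finset.sum_le_sum_of_subset (Finset.range_mono (S.le_K m))
    _ ≤ _ := S.sum_jonesTerm_le ω hN m
    _ ≤ _ := by
        apply ENNReal.ofReal_le_ofReal
        have h1 : (0 : ℝ) < 1 / 2 ^ m := by positivity
        have h2 : 64 / (S.N : ℝ) * (2 * (1 - 1 / 2 ^ m)) ≤ 64 / S.N * 2 := by
          gcongr
          linarith
        calc _ ≤ 1 / (S.N : ℝ) + 64 / S.N * 2 := by linarith
          _ = 129 / S.N := by ring

/-! ### Lower density zero almost everywhere -/

lemma ball_subset_triple {Q : DyadicSquare} {x : Plane} (hx : x ∈ Q.toSet) :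
    Metric.ball x Q.side ⊆ Q.triple := by
  intro y hy i
  have h1 : |y i - x i| < Q.side := by
    refine lt_of_le_of_lt ?_ (Metric.mem_ball.1 hy)
    rw [dist_eq_norm]
    simpa using PiLp.norm_apply_le (y - x) i
  have h2 := hx i
  rw [abs_lt] at h1
  constructor <;> nlinarith [h2.1, h2.2]

variable {S} in
/-- Below the scale of its distance to the main row, a low row has small density. -/
lemma measure_ball_div_le {ω : S.Code} {n : ℕ} (h : ((ω n).2 : ℕ) ≠ 0) :
    S.measure (Metric.ball (S.point ω) (1 / 2 ^ (S.K n + (2 * ((ω n).2 : ℕ) + 1)))) /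
      ENNReal.ofReal (2 * (1 / 2 ^ (S.K n + (2 * ((ω n).2 : ℕ) + 1)))) ≤
      ENNReal.ofReal (2 / (n + 1)) := by
  set t := 2 * ((ω n).2 : ℕ) + 1 with ht_def
  have hj := (ω n).2.2
  have hL := S.two_mul_add_four_le n
  have ht : t < S.L n := by omega
  have htA : t ≤ 2 * S.M n + 2 := by omega
  have hM := S.cast_M_pos n
  set Q := DyadicSquare.around (S.point ω) (S.K n + t) with hQ_def
  have hQ : Q.k = ((S.K n + t : ℕ) : ℤ) := rfl
  have hω : S.point ω ∈ Q.toSet := DyadicSquare.mem_around _ _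
  have hs : Q.side = 1 / 2 ^ (S.K n + t) := side_eq hQ
  have hiso : Isolated t (ω n) := Or.inl ⟨h, by omega⟩
  have hle : S.measure (Metric.ball (S.point ω) (1 / 2 ^ (S.K n + t))) ≤
      ENNReal.ofReal (S.mass ω n * (3 / 2 ^ t * S.rowWeight n (ω n).2)) := by
    rw [← hs]
    refine (measure_mono (ball_subset_triple hω)).trans ?_
    rw [S.measure_apply Q.measurableSet_triple]
    refine le_trans (measure_mono ?_) (codeMeasure_row_inter_le htA ht hQ hω (ω n).2)
    refine fun ω' hω' => ⟨?_, hω'⟩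
    exact hiso.row_eq ht ((mem_cylinder_of_mem_triple ht.le hQ hω hω').2 1)
  refine (ENNReal.div_le_div_right hle _).trans ?_
  rw [← ENNReal.ofReal_div_of_pos (by positivity)]
  apply ENNReal.ofReal_le_ofReal
  rw [S.rowWeight_of_ne_zero h]
  have hm := S.mass_le_one ω n
  have hm0 := S.mass_nonneg ω n
  -- The stage `n` square may have density as large as `2 ^ K n`; spreading the mass over this many
  -- rows brings it below a constant over `n + 1`.
  have hMK : ((n : ℝ) + 1) * 2 ^ S.K n ≤ S.M n := by exact_mod_cast S.le_M n
  have hn : (0 : ℝ) ≤ n := Nat.cast_nonneg n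
  calc _ = S.mass ω n * (3 / 2) * ((n + 1) / (n + 2)) * (2 ^ S.K n / S.M n) := by
        rw [pow_add _ _ t]
        generalize t = s
        field_simp
    _ ≤ 1 * (3 / 2) * 1 * (1 / (n + 1)) := by
        gcongr ?_ * _ * ?_ * ?_
        · rw [div_le_one (by positivity)]
          linarith
        · rw [div_le_div_iff₀ hM (by positivity)]
          linarith
    _ ≤ 2 / (n + 1) := by
        rw [one_mul, mul_one, mul_one_div]
        gcongr
        norm_num

lemma lowerDensityOne_eq_zero {ω : S.Code} (h : ∃ᶠ n in atTop, ((ω n).2 : ℕ) ≠ 0) :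
    lowerDensityOne S.measure (S.point ω) = 0 := by
  refine le_antisymm (ENNReal.le_of_forall_pos_le_add fun a ha _ => ?_) zero_le
  have ha' : (0 : ℝ) < a := ha
  rw [zero_add]
  refine liminf_le_of_frequently_le' ?_
  have htend : Tendsto (fun n => (1 : ℝ) / 2 ^ (S.K n + (2 * ((ω n).2 : ℕ) + 1))) atTop
      (𝓝[>] (0 : ℝ)) := by
    refine tendsto_nhdsWithin_iff.2 ⟨?_, Eventually.of_forall fun n => ?_⟩
    · refine squeeze_zero (fun n => by positivity) (fun n => ?_)
        (tendsto_pow_atTop_nhds_zero_of_lt_one (by norm_num) (by norm_num : (1 / 2 : ℝ) < 1))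
      rw [div_pow, one_pow]
      exact one_div_le_one_div_of_le (by positivity)
        (pow_le_pow_right₀ one_le_two ((S.le_K n).trans (Nat.le_add_right _ _)))
    · rw [Set.mem_Ioi]
      positivity
  refine htend.frequently ?_
  have hev : ∀ᶠ n : ℕ in atTop, 2 / ((n : ℝ) + 1) ≤ a := by
    filter_upwards [eventually_ge_atTop ⌈2 / (a : ℝ)⌉₊] with n hn
    have h1 := Nat.ceil_le.1 hn
    rw [div_le_iff₀ ha'] at h1
    rw [div_le_iff₀ (by positivity)]
    linarith
  refine (h.and_eventually hev).mono fun n hn => ?_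
  refine (measure_ball_div_le hn.1).trans ?_
  rw [← ENNReal.ofReal_coe_nnreal]
  exact ENNReal.ofReal_le_ofReal hn.2

lemma codeMeasure_main_row (n : ℕ) :
    S.codeMeasure {ω | ((ω n).2 : ℕ) = 0} = ENNReal.ofReal (1 / (n + 2)) := by
  have h1 : {ω : S.Code | ((ω n).2 : ℕ) = 0} = (fun ω : S.Code => ω n) ⁻¹'
      (((Finset.univ : Finset (Fin (2 ^ (2 * S.M n + 2)))) : Set _) ×ˢ {0}) := by
    ext ω
    simp only [Set.mem_ofPred_eq, Set.mem_preimage, Set.mem_prod, Finset.coe_univ, Set.mem_univ,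
      true_and, Set.mem_singleton_iff, Fin.ext_iff]
    rfl
  have h2 := S.labelMeasure_prod n Finset.univ 0
  rw [h1, codeMeasure, (measurePreserving_eval_infinitePi S.labelMeasure n).measure_preimage
    MeasurableSet.of_discrete.nullMeasurableSet, h2, S.rowWeight_of_eq_zero rfl]
  simp

/-- No product is needed: the event lies in that of using the main row at one stage `n`, of
probability `1 / (n + 2)`, with `n` as large as desired. -/
lemma codeMeasure_eventually_main_row (m : ℕ) :
    S.codeMeasure {ω | ∀ n ≥ m, ((ω n).2 : ℕ) = 0} = 0 := by
  refine le_antisymm (ENNReal.le_of_forall_pos_le_add fun a ha _ => ?_) zero_le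
  have ha' : (0 : ℝ) < a := ha
  rw [zero_add]
  set n := max m ⌈1 / (a : ℝ)⌉₊ with hn
  calc _ ≤ S.codeMeasure {ω | ((ω n).2 : ℕ) = 0} := 
        measure_mono (by intro ω hω; exact hω n (le_max_left _ _))
    _ = ENNReal.ofReal (1 / (n + 2)) := S.codeMeasure_main_row n
    _ ≤ ENNReal.ofReal a := by
        apply ENNReal.ofReal_le_ofReal
        have h1 := Nat.ceil_le.1 (le_max_right m ⌈1 / (a : ℝ)⌉₊)
        rw [div_le_iff₀ ha'] at h1
        rw [div_le_iff₀ (by positivity)]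
        nlinarith
    _ = a := ENNReal.ofReal_coe_nnreal

theorem ae_lowerDensityOne_eq_zero : ∀ᵐ x ∂S.measure, lowerDensityOne S.measure x = 0 := by
  have hrange : IsCompact (Set.range S.point) := isCompact_range S.continuous_point
  have hsub : {x | ¬ lowerDensityOne S.measure x = 0} ⊆ (Set.range S.point)ᶜ ∪
      ⋃ m, S.point '' {ω | ∀ n ≥ m, ((ω n).2 : ℕ) = 0} := by
    intro x hx
    by_cases hmem : x ∈ Set.range S.point
    · obtain ⟨ω, rfl⟩ := hmem
      right
      by_contra hnot
      refine hx (S.lowerDensityOne_eq_zero ?_)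
      rw [frequently_atTop]
      intro m
      by_contra! hm
      exact hnot (Set.mem_iUnion.2 ⟨m, ω, hm, rfl⟩)
    · exact Or.inl hmem
  refine ae_iff.2 (measure_mono_null hsub (measure_union_null ?_ (measure_iUnion_null fun m => ?_)))
  · rw [S.measure_apply hrange.isClosed.measurableSet.compl]
    convert measure_empty (μ := S.codeMeasure)
    ext ω
    simp
  · have hclosed : IsClosed {ω : S.Code | ∀ n ≥ m, ((ω n).2 : ℕ) = 0} := by
      simp only [Set.ofPred_forall]
      refine isClosed_iInter fun n => isClosed_iInter fun _ => ?_
      have : Continuous fun ω : S.Code => ((ω n).2 : ℕ) :=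
        (continuous_of_discreteTopology (f := fun p : S.Label n => (p.2 : ℕ))).comp
          (continuous_apply n)
      exact isClosed_singleton.preimage this
    have hcomp := hclosed.isCompact.image S.continuous_point
    rw [S.measure_apply hcomp.isClosed.measurableSet, S.point_injective.preimage_image]
    exact S.codeMeasure_eventually_main_row m

end Scheme

/-! ### The theorem -/

theorem theorem1p1 (ε : ℝ) (hε : 0 < ε) :
    ∃ μ : Measure Plane,
      IsProbabilityMeasure μ ∧ μ.Regular ∧ μ.support ⊆ unitSquare ∧
      (∀ x ∈ μ.support, jonesSquare μ x ≤ ENNReal.ofReal ε) ∧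
      (∀ᵐ x ∂μ, lowerDensityOne μ x = 0) ∧
      IsPurelyOneUnrectifiable μ ∧ ¬ IsOneRectifiable μ := by
  -- The square function is at most `129 / N`; the added `1` keeps `N` positive.
  obtain ⟨S, hS⟩ := Scheme.exists_scheme (⌈129 / ε⌉₊ + 1)
  have hN : 0 < S.N := by omega
  have hdens := S.ae_lowerDensityOne_eq_zero
  have hpure := isPurelyOneUnrectifiable_of_lowerDensityOne hdens
  refine ⟨S.measure, inferInstance, inferInstance, S.support_subset, fun x hx => ?_, hdens, hpure,
    not_isOneRectifiable_of_isPurelyOneUnrectifiable hpure⟩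
  obtain ⟨ω, rfl⟩ := S.exists_of_mem_support hx
  refine (S.jonesSquare_le ω hN).trans (ENNReal.ofReal_le_ofReal ?_)
  have h1 : 129 / ε ≤ S.N := by
    rw [hS]
    push_cast
    linarith [Nat.le_ceil (129 / ε)]
  rw [div_le_iff₀ hε] at h1
  rw [div_le_iff₀ (Nat.cast_pos.2 hN)]
  linarith
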